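/- Let $p\ge 1$, let $\mu,\beta\in\mathbf R^p$ and let $A$ be a full-rank real $p\times p$ matrix. Let $X$ be a random variable supported on $(0,\infty)$ with Lebesgue density $g$ on $(0,\infty)$, let $Z$ be a standard normal vector in $\mathbf R^p$ independent of $X$, and let $Y=\mu+\beta X+\sqrt{X}\,AZ$. Then $Y$ has the density $$f(y)=\int_0^\infty \frac{1}{(2\pi x)^{p/2}\,|\det A|}\exp\left(-\frac{\|A^{-1}(y-\mu-\beta x)\|^2}{2x}\right)g(x)\,dx\in[0,\infty],\qquad y\in\mathbf R^p,$$ and below $f$ denotes this version of the density (the value $+\infty$ is allowed, and can occur only at $y=\mu$). For $x>0$ put $g^*(x)=x^{-(p-1)/2}g(x)$. Here a function $h$ on $(0,\infty)$ is unimodal if there is $m\in\mathbf R$ such that $h$ is increasing on $(0,\infty)\cap(-\infty,m]$ and decreasing on $(0,\infty)\cap[m,\infty)$ (increasing and decreasing in the weak sense); a nonnegative function $h$ on a convex set is log-concave if $h(\theta x+(1-\theta)y)\ge h(x)^\theta h(y)^{1-\theta}$ for all $x,y$ in it and all $\theta\in(0,1)$; a positive function $h$ on an interval is log-convex if $\log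 h$ is convex. (i) If $g^*$ is unimodal on $(0,\infty)$, then $f$ has exactly one local maximum point, and it lies on the line $\{\mu+\beta t: t\in\mathbf R\}$. (ii) If $g^*$ is decreasing on $(0,\infty)$, or if $\beta=0$, then the one and only local maximum point of $f$ is $y=\mu$. (iii) If $g^*$ is log-concave on $(0,\infty)$, then $f$ is finite and log-concave on $\mathbf R^p$. (iv) If $g^*$ is log-convex on $(0,\infty)$, then for every nonzero $b\in\mathbf R^p$ the function $t\mapsto f(\mu+bt)$ is finite and log-convex on $(0,\infty)$. -/

import Mathlib

open MeasureTheory ProbabilityTheory Set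
open scoped ENNReal

namespace NormalMixture

/-- A real function `h` is unimodal on a set `I` of reals (in practice an interval): for some real
`m`, which need not lie in `I`, it is (weakly) increasing on the part of `I` up to `m` and (weakly)
decreasing on the part of `I` from `m` on. -/
def UnimodalOn (I : Set ℝ) (h : ℝ → ℝ) : Prop :=
  ∃ m : ℝ, MonotoneOn h (I ∩ Iic m) ∧ AntitoneOn h (I ∩ Ici m)

/-- A function is log-concave on a convex set `s` if it is nonnegative there and
`h (θ x + (1 - θ) y) ≥ h x ^ θ * h y ^ (1 - θ)` for all `x, y ∈ s` and `0 < θ < 1`. -/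
def LogConcaveOn {E : Type*} [AddCommGroup E] [Module ℝ E] (s : Set E) (h : E → ℝ) : Prop :=
  Convex ℝ s ∧ (∀ x ∈ s, 0 ≤ h x) ∧
    ∀ x ∈ s, ∀ y ∈ s, ∀ θ ∈ Ioo (0 : ℝ) 1,
      h x ^ θ * h y ^ (1 - θ) ≤ h (θ • x + (1 - θ) • y)

/-- A function is log-convex on a set `I` of reals if it is positive there and its logarithm is
convex on `I`. -/
def LogConvexOn (I : Set ℝ) (h : ℝ → ℝ) : Prop :=
  (∀ x ∈ I, 0 < h x) ∧ ConvexOn ℝ I (fun x => Real.log (h x))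

/-- The modified mixing density `x ^ (-(p - 1) / 2) * g x`; it is only used for `x > 0`. -/
noncomputable def gStar (p : ℕ) (g : ℝ → ℝ) (x : ℝ) : ℝ :=
  x ^ (-((p : ℝ) - 1) / 2) * g x

/-- The density at `y` of the normal variance-mean mixture: the density at `y` of the normal
distribution with mean `μ + x β` and covariance matrix `x A Aᵀ`, integrated against the mixing
density `g` over `x > 0`. The value at `y = μ` may be `∞`. -/
noncomputable def mixtureDensity {p : ℕ} (μ β : EuclideanSpace ℝ (Fin p))
    (A : Matrix (Fin p) (Fin p) ℝ) (g : ℝ → ℝ) (y : EuclideanSpace ℝ (Fin p)) : ℝ≥0∞ :=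
  ∫⁻ x in Ioi (0 : ℝ), ENNReal.ofReal
    ((2 * Real.pi * x) ^ (-(p : ℝ) / 2) * |A.det|⁻¹ *
      Real.exp (-‖Matrix.toEuclideanLin A⁻¹ (y - μ - x • β)‖ ^ 2 / (2 * x)) * g x)

end NormalMixture

/-! Put `w = A⁻¹(y - μ)`, `γ = A⁻¹β`. Expanding the square in the Gaussian exponent gives `f(y) = C
· exp⟨w, γ⟩ · F(‖w‖²/2)`, where `F(s) = ∫ exp(-s/x) G(x) dx` and `G(x) = x^(-1/2) exp(-‖γ‖² x/2)
g*(x)`. Everything thus rests on how the transform `F` carries the shape of `g*` into the shape of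
`r ↦ F(r²/2)`.

The transform is variation diminishing: in `u = 1/x` its kernel is `exp(-s u)`, and a combination of
two or three exponentials can be given sign changes at one or two prescribed points. If `G₁ - G₂`
has sign pattern `-, +, -`, the transforms at three points therefore cannot show the pattern `+, -,
+` (`expMix_three_point`); `expMix_two_point` is the analogue with one sign change.

The comparison functions are `c x^(-1/2) exp(-a² x/2)`, whose transform at `r²/2` is a constant
times `exp(-a r)` (`expMix_expKernel`). Comparing `G` with one of them amounts to comparing `g*`
with `c exp(k x)`, where `k = (‖γ‖² - a²)/2`.

For `a = ‖γ‖` the comparison is of `g*` with constants, and the transform becomes constant after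
multiplication by `exp(‖γ‖ r)`. So if `g*` is unimodal, the profile `exp(‖γ‖ r) F(r²/2)` along the
ray of `γ` is strictly quasiconcave; if `g*` is decreasing, so is the profile, strictly. Strictness
holds because `g` would otherwise be a multiple of `x^((p-1)/2)`, which is not integrable. On a
sphere of fixed `‖w‖` the tilt is greatest on that ray, so local maxima of `f` reduce to those of
the profile. For `β = 0`, `f` is a strictly decreasing function of `‖w‖`.

For general `a`, take the comparison function whose transform agrees with `F` at two points.
Log-concavity of `g*` makes `{g* ≥ c exp(k x)}` an interval, so `log F(r²/2)` lies above its chords;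
log-convexity makes `{g* ≤ c exp(k x)}` an interval and reverses the inequality. -/

namespace NormalMixture

/-! ### The law of the mixture -/

/-- The standard Gaussian measure on `EuclideanSpace ℝ (Fin p)` in terms of Lebesgue measure. -/
theorem stdGaussian_eq_withDensity (p : ℕ) :
    stdGaussian (EuclideanSpace ℝ (Fin p)) =
      (volume : Measure (EuclideanSpace ℝ (Fin p))).withDensity (fun z =>
        ENNReal.ofReal ((2 * Real.pi) ^ (-(p : ℝ) / 2) * Real.exp (-‖z‖ ^ 2 / 2))) := by
  have hint : Integrable (fun z : EuclideanSpace ℝ (Fin p) =>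
      (2 * Real.pi) ^ (-(p : ℝ) / 2) * Real.exp (-‖z‖ ^ 2 / 2)) := by
    have h := (GaussianFourier.integrable_cexp_neg_mul_sq_norm_add
      (b := 1 / 2) (by norm_num) 0 (0 : EuclideanSpace ℝ (Fin p))).norm
    refine Integrable.const_mul (h.congr (ae_of_all _ fun z => ?_)) _
    dsimp only
    rw [Complex.norm_exp]
    congr 1
    rw [← Complex.ofReal_pow]
    simp [-Complex.ofReal_pow]
    ring
  have hfin : IsFiniteMeasure ((volume : Measure (EuclideanSpace ℝ (Fin p))).withDensity (fun z =>
      ENNReal.ofReal ((2 * Real.pi) ^ (-(p : ℝ) / 2) * Real.exp (-‖z‖ ^ 2 / 2)))) :=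
    isFiniteMeasure_withDensity_ofReal hint.2
  apply Measure.ext_of_charFun
  ext t
  rw [charFun_stdGaussian, charFun_apply]
  rw [integral_withDensity_eq_integral_toReal_smul (by fun_prop) (by simp)]
  have h : ∀ z : EuclideanSpace ℝ (Fin p),
      (ENNReal.ofReal ((2 * Real.pi) ^ (-(p : ℝ) / 2) * Real.exp (-‖z‖ ^ 2 / 2))).toReal •
        Complex.exp (inner ℝ z t * Complex.I) =
      (((2 * Real.pi) ^ (-(p : ℝ) / 2) : ℝ) : ℂ) *
        Complex.exp (-(1 / 2 : ℂ) * ‖z‖ ^ 2 + Complex.I * inner ℝ t z) := by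
    intro z
    rw [ENNReal.toReal_ofReal (by positivity), Complex.real_smul, Complex.ofReal_mul, mul_assoc,
      Complex.ofReal_exp, ← Complex.exp_add, real_inner_comm]
    congr 2
    push_cast
    ring
  simp_rw [h]
  rw [integral_const_mul, GaussianFourier.integral_cexp_neg_mul_sq_norm_add (by norm_num)]
  have e1 : ((Real.pi : ℂ) / (1 / 2)) = ((2 * Real.pi : ℝ) : ℂ) := by push_cast; ring
  have e2 : ((Module.finrank ℝ (EuclideanSpace ℝ (Fin p)) : ℂ) / 2) = (((p : ℝ) / 2 : ℝ) : ℂ) := by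
    simp
  rw [e1, e2, ← Complex.ofReal_cpow (by positivity), ← mul_assoc, ← Complex.ofReal_mul,
    ← Real.rpow_add (by positivity)]
  have e3 : -(p : ℝ) / 2 + (p : ℝ) / 2 = 0 := by ring
  rw [e3, Real.rpow_zero, Complex.ofReal_one, one_mul]
  congr 1
  rw [Complex.I_sq]
  ring

theorem toEuclideanLin_inv_apply {p : ℕ} {A : Matrix (Fin p) (Fin p) ℝ} (hA : IsUnit A.det)
    (z : EuclideanSpace ℝ (Fin p)) :
    Matrix.toEuclideanLin A⁻¹ (Matrix.toEuclideanLin A z) = z := by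
  ext i
  simp [Matrix.toLpLin_apply, Matrix.mulVec_mulVec, Matrix.nonsing_inv_mul A hA]

theorem toEuclideanLin_apply_inv {p : ℕ} {A : Matrix (Fin p) (Fin p) ℝ} (hA : IsUnit A.det)
    (z : EuclideanSpace ℝ (Fin p)) :
    Matrix.toEuclideanLin A (Matrix.toEuclideanLin A⁻¹ z) = z := by
  ext i
  simp [Matrix.toLpLin_apply, Matrix.mulVec_mulVec, Matrix.mul_nonsing_inv A hA]

/-- The law of `m + √x A Z` for a standard Gaussian vector `Z`. -/
theorem lintegral_stdGaussian_affine {p : ℕ} {A : Matrix (Fin p) (Fin p) ℝ} (hA : IsUnit A.det)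
    (m : EuclideanSpace ℝ (Fin p)) {x : ℝ} (hx : 0 < x)
    {F : EuclideanSpace ℝ (Fin p) → ℝ≥0∞} (hF : Measurable F) :
    ∫⁻ z, F (m + Real.sqrt x • Matrix.toEuclideanLin A z)
        ∂(stdGaussian (EuclideanSpace ℝ (Fin p))) =
      ∫⁻ y, ENNReal.ofReal ((2 * Real.pi * x) ^ (-(p : ℝ) / 2) * |A.det|⁻¹ *
        Real.exp (-‖Matrix.toEuclideanLin A⁻¹ (y - m)‖ ^ 2 / (2 * x))) * F y := by
  have hsx : 0 < Real.sqrt x := Real.sqrt_pos.2 hx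
  have hcont : ∀ B : Matrix (Fin p) (Fin p) ℝ, Continuous (Matrix.toEuclideanLin B) := fun B =>
    LinearMap.continuous_of_finiteDimensional _
  have hm1 : Measurable (Matrix.toEuclideanLin A) := (hcont A).measurable
  have hm2 : Measurable (Matrix.toEuclideanLin A⁻¹) := (hcont A⁻¹).measurable
  set S : EuclideanSpace ℝ (Fin p) →ₗ[ℝ] EuclideanSpace ℝ (Fin p) :=
    Real.sqrt x • Matrix.toEuclideanLin A with hS
  have hdetS : LinearMap.det S = Real.sqrt x ^ p * A.det := by
    rw [hS, LinearMap.det_smul, LinearMap.det_toLpLin]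
    simp
  have hdet0 : LinearMap.det S ≠ 0 := by
    rw [hdetS]
    exact mul_ne_zero (pow_ne_zero _ hsx.ne') hA.ne_zero
  have hSm : Measurable S := (LinearMap.continuous_of_finiteDimensional S).measurable
  set H : EuclideanSpace ℝ (Fin p) → ℝ≥0∞ := fun y =>
    ENNReal.ofReal ((2 * Real.pi * x) ^ (-(p : ℝ) / 2) * |A.det|⁻¹ *
        Real.exp (-‖Matrix.toEuclideanLin A⁻¹ (y - m)‖ ^ 2 / (2 * x))) * F y with hH
  have hHm : Measurable H := by fun_prop
  have hdpos : 0 < |LinearMap.det S| := abs_pos.2 hdet0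
  have hchange : ∫⁻ y, H y = ENNReal.ofReal |LinearMap.det S| * ∫⁻ z, H (m + S z) := by
    rw [← lintegral_add_left_eq_self H m]
    rw [← lintegral_map (f := fun y => H (m + y)) (by fun_prop) hSm,
      Measure.map_linearMap_addHaar_eq_smul_addHaar _ hdet0, lintegral_smul_measure, smul_eq_mul,
      ← mul_assoc, ← ENNReal.ofReal_mul (abs_nonneg _), ← abs_mul, mul_inv_cancel₀ hdet0]
    simp
  rw [hchange, stdGaussian_eq_withDensity, lintegral_withDensity_eq_lintegral_mul _ (by fun_prop)
    (by fun_prop), ← lintegral_const_mul _ (by fun_prop)]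
  refine lintegral_congr fun z => ?_
  have e1 : Matrix.toEuclideanLin A⁻¹ (m + S z - m) = Real.sqrt x • z := by
    rw [add_sub_cancel_left, hS, LinearMap.smul_apply, map_smul, toEuclideanLin_inv_apply hA]
  have e2 : -‖Real.sqrt x • z‖ ^ 2 / (2 * x) = -‖z‖ ^ 2 / 2 := by
    rw [norm_smul, mul_pow, Real.norm_of_nonneg hsx.le, Real.sq_sqrt hx.le]
    field_simp
  have e3 : |LinearMap.det S| * ((2 * Real.pi * x) ^ (-(p : ℝ) / 2) * |A.det|⁻¹) =
      (2 * Real.pi) ^ (-(p : ℝ) / 2) := by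
    have : x ^ (-(p : ℝ) / 2) = (Real.sqrt x ^ p)⁻¹ := by
      rw [Real.sqrt_eq_rpow, ← Real.rpow_natCast, ← Real.rpow_mul hx.le, ← Real.rpow_neg hx.le]
      congr 1
      ring
    rw [hdetS, abs_mul, Real.mul_rpow (by positivity) hx.le, this, abs_of_pos (pow_pos hsx p)]
    have : |A.det| ≠ 0 := abs_ne_zero.2 hA.ne_zero
    field_simp
  simp only [hH, Pi.mul_apply]
  rw [e1, e2, ← mul_assoc, ← ENNReal.ofReal_mul (abs_nonneg _), ← mul_assoc, e3]
  rfl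

/-- The normal variance-mean mixture has density `mixtureDensity`. -/
theorem hasLaw_mixture {p : ℕ} (μ β : EuclideanSpace ℝ (Fin p))
    {A : Matrix (Fin p) (Fin p) ℝ} (hA : IsUnit A.det)
    {g : ℝ → ℝ} (hg_meas : AEMeasurable g (volume.restrict (Ioi (0 : ℝ))))
    {Ω : Type*} [MeasurableSpace Ω] {P : Measure Ω} [IsProbabilityMeasure P]
    {X : Ω → ℝ} {Z : Ω → EuclideanSpace ℝ (Fin p)}
    (hX : HasLaw X ((volume.restrict (Ioi (0 : ℝ))).withDensity
      (fun x => ENNReal.ofReal (g x))) P)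
    (hZ : HasLaw Z (stdGaussian (EuclideanSpace ℝ (Fin p))) P)
    (hXZ : IndepFun X Z P) :
    HasLaw (fun ω => μ + X ω • β + Real.sqrt (X ω) • Matrix.toEuclideanLin A (Z ω))
      ((volume : Measure (EuclideanSpace ℝ (Fin p))).withDensity (mixtureDensity μ β A g)) P := by
  have hcont : ∀ B : Matrix (Fin p) (Fin p) ℝ, Continuous (Matrix.toEuclideanLin B) := fun B =>
    LinearMap.continuous_of_finiteDimensional _
  have hm1 : Measurable (Matrix.toEuclideanLin A) := (hcont A).measurable
  have hm2 : Measurable (Matrix.toEuclideanLin A⁻¹) := (hcont A⁻¹).measurable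
  have hXm := hX.aemeasurable
  have hZm := hZ.aemeasurable
  have hΦ : Measurable (fun q : ℝ × EuclideanSpace ℝ (Fin p) =>
      μ + q.1 • β + Real.sqrt q.1 • Matrix.toEuclideanLin A q.2) := by fun_prop
  have hgm : AEMeasurable (fun x => ENNReal.ofReal (g x)) (volume.restrict (Ioi (0 : ℝ))) :=
    hg_meas.ennreal_ofReal
  have e0 : (fun ω => μ + X ω • β + Real.sqrt (X ω) • Matrix.toEuclideanLin A (Z ω)) =
    (fun q : ℝ × EuclideanSpace ℝ (Fin p) =>
      μ + q.1 • β + Real.sqrt q.1 • Matrix.toEuclideanLin A q.2) ∘ (fun ω => (X ω, Z ω)) := rfl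
  rw [e0]
  refine ⟨hΦ.comp_aemeasurable (hXm.prodMk hZm), ?_⟩
  have hjoint := (indepFun_iff_map_prod_eq_prod_map_map hXm hZm).1 hXZ
  rw [hX.map_eq, hZ.map_eq] at hjoint
  have hkm : AEMeasurable (fun q : ℝ × EuclideanSpace ℝ (Fin p) => ENNReal.ofReal
      ((2 * Real.pi * q.1) ^ (-(p : ℝ) / 2) * |A.det|⁻¹ *
      Real.exp (-‖Matrix.toEuclideanLin A⁻¹ (q.2 - μ - q.1 • β)‖ ^ 2 / (2 * q.1)) * g q.1))
      ((volume.restrict (Ioi (0 : ℝ))).prod volume) := by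
    have h1 : Measurable (fun q : ℝ × EuclideanSpace ℝ (Fin p) =>
        (2 * Real.pi * q.1) ^ (-(p : ℝ) / 2) * |A.det|⁻¹ *
        Real.exp (-‖Matrix.toEuclideanLin A⁻¹ (q.2 - μ - q.1 • β)‖ ^ 2 / (2 * q.1))) := by fun_prop
    have h2 : AEMeasurable (fun q : ℝ × EuclideanSpace ℝ (Fin p) => g q.1)
        ((volume.restrict (Ioi (0 : ℝ))).prod volume) := hg_meas.comp_fst
    exact (h1.aemeasurable.mul h2).ennreal_ofReal
  have hfm : AEMeasurable (mixtureDensity μ β A g) volume := by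
    have := hkm.prod_swap.lintegral_prod_right'
    exact this
  refine Measure.ext_of_lintegral _ fun F hF => ?_
  rw [← AEMeasurable.map_map_of_aemeasurable hΦ.aemeasurable (hXm.prodMk hZm), hjoint,
    lintegral_map hF hΦ]
  have hprod := lintegral_prod (μ := (volume.restrict (Ioi (0 : ℝ))).withDensity
      (fun x => ENNReal.ofReal (g x))) (ν := stdGaussian (EuclideanSpace ℝ (Fin p)))
      (fun q : ℝ × EuclideanSpace ℝ (Fin p) =>
        F (μ + q.1 • β + Real.sqrt q.1 • Matrix.toEuclideanLin A q.2))
      (hF.comp hΦ).aemeasurable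
  have hin : Measurable (fun x : ℝ => ∫⁻ z, F (μ + x • β + Real.sqrt x • Matrix.toEuclideanLin A z)
      ∂(stdGaussian (EuclideanSpace ℝ (Fin p)))) :=
    Measurable.lintegral_prod_right' (hF.comp hΦ)
  rw [hprod]
  rw [lintegral_withDensity_eq_lintegral_mul₀ hgm hin.aemeasurable,
    lintegral_withDensity_eq_lintegral_mul₀ hfm hF.aemeasurable]
  have hR : ∀ y, (mixtureDensity μ β A g * F) y = ∫⁻ x in Ioi (0 : ℝ), ENNReal.ofReal
      ((2 * Real.pi * x) ^ (-(p : ℝ) / 2) * |A.det|⁻¹ *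
      Real.exp (-‖Matrix.toEuclideanLin A⁻¹ (y - μ - x • β)‖ ^ 2 / (2 * x)) * g x) * F y := by
    intro y
    rw [lintegral_mul_const'' _ _, Pi.mul_apply, mixtureDensity]
    have h1 : Measurable (fun x : ℝ =>
        (2 * Real.pi * x) ^ (-(p : ℝ) / 2) * |A.det|⁻¹ *
        Real.exp (-‖Matrix.toEuclideanLin A⁻¹ (y - μ - x • β)‖ ^ 2 / (2 * x))) := by fun_prop
    exact (h1.aemeasurable.mul hg_meas).ennreal_ofReal
  simp_rw [hR]
  -- After Tonelli the inner integral is over `y` with `x` fixed, where the conditional law is a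
  -- Gaussian with a known density.
  rw [lintegral_lintegral_swap]
  · refine setLIntegral_congr_fun measurableSet_Ioi fun x hx => ?_
    have hx' : (0 : ℝ) < x := hx
    simp only [Pi.mul_apply]
    rw [lintegral_stdGaussian_affine hA (μ + x • β) hx' hF, ← lintegral_const_mul _ (by fun_prop)]
    refine lintegral_congr fun y => ?_
    rw [← mul_assoc, mul_comm (ENNReal.ofReal (g x)), ← ENNReal.ofReal_mul (by positivity),
      sub_add_eq_sub_sub]
  · exact (hkm.prod_swap).mul (hF.comp measurable_fst).aemeasurable

/-! ### Exponential sums and the variation-diminishing property -/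

/-- Strict convexity of the exponential sum. The first term alone gives strictness, so `l` is
unrestricted. -/
theorem exp_add_exp_lt_of_mem_Ioo {α₁ α₃ k l c a b z : ℝ} (h₁ : 0 < α₁) (h₃ : 0 < α₃) (hk : 0 < k)
    (hz : z ∈ Ioo a b)
    (ha : α₁ * Real.exp (k * a) + α₃ * Real.exp (-(l * a)) ≤ c)
    (hb : α₁ * Real.exp (k * b) + α₃ * Real.exp (-(l * b)) ≤ c) :
    α₁ * Real.exp (k * z) + α₃ * Real.exp (-(l * z)) < c := by
  obtain ⟨haz, hzb⟩ := hz
  have hab : 0 < b - a := by linarith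
  set t := (b - z) / (b - a) with ht
  have ht0 : 0 < t := div_pos (by linarith) hab
  have ht1 : 0 < 1 - t := by
    rw [ht, sub_pos, div_lt_one hab]
    linarith
  have hzt : z = t * a + (1 - t) * b := by
    rw [ht]
    field_simp
    ring
  have e1 : Real.exp (k * z) < t * Real.exp (k * a) + (1 - t) * Real.exp (k * b) := by
    have := strictConvexOn_exp.2 (mem_univ (k * a)) (mem_univ (k * b))
      (fun h => by have := mul_left_cancel₀ hk.ne' h; linarith) ht0 ht1 (by ring)
    simp only [smul_eq_mul] at this
    rwa [show t * (k * a) + (1 - t) * (k * b) = k * z by rw [hzt]; ring] at this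
  have e3 : Real.exp (-(l * z)) ≤ t * Real.exp (-(l * a)) + (1 - t) * Real.exp (-(l * b)) := by
    have := convexOn_exp.2 (mem_univ (-(l * a))) (mem_univ (-(l * b))) ht0.le ht1.le (by ring)
    simp only [smul_eq_mul] at this
    rwa [show t * -(l * a) + (1 - t) * -(l * b) = -(l * z) by rw [hzt]; ring] at this
  calc _ < α₁ * (t * Real.exp (k * a) + (1 - t) * Real.exp (k * b)) +
        α₃ * (t * Real.exp (-(l * a)) + (1 - t) * Real.exp (-(l * b))) :=
        add_lt_add_of_lt_of_le (mul_lt_mul_of_pos_left e1 h₁) (mul_le_mul_of_nonneg_left e3 h₃.le)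
    _ = t * (α₁ * Real.exp (k * a) + α₃ * Real.exp (-(l * a))) +
        (1 - t) * (α₁ * Real.exp (k * b) + α₃ * Real.exp (-(l * b))) := by ring
    _ ≤ t * c + (1 - t) * c := add_le_add (mul_le_mul_of_nonneg_left ha ht0.le)
        (mul_le_mul_of_nonneg_left hb ht1.le)
    _ = c := by ring

/-- A combination of two exponentials and a constant whose sign on `(0, ∞)` is prescribed by an
interval `J`. -/
theorem exists_exp_sign {J : Set ℝ} (hJ : J.OrdConnected) (hpos : J ⊆ Ioi 0) {k l : ℝ}
    (hk : 0 < k) (hl : 0 < l) :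
    ∃ α₁ α₂ α₃ a b : ℝ, 0 ≤ α₁ ∧ 0 < α₂ ∧ 0 ≤ α₃ ∧ ∀ u, u ≠ a → u ≠ b →
      (u ∈ J → α₁ * Real.exp (k * u) + α₃ * Real.exp (-(l * u)) < α₂) ∧
      (u ∉ J → 0 < u → α₂ < α₁ * Real.exp (k * u) + α₃ * Real.exp (-(l * u))) := by
  have hbelow : BddBelow J := ⟨0, fun x hx => (hpos hx).le⟩
  by_cases hab : BddAbove J
  · by_cases hlt : sInf J < sSup J
    · set a := sInf J
      set b := sSup J
      have hne : J.Nonempty := by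
        by_contra h
        rw [not_nonempty_iff_eq_empty] at h
        simp [a, b, h] at hlt
      have h₁ : 0 < Real.exp (-(l * a)) - Real.exp (-(l * b)) := by
        rw [sub_pos, Real.exp_lt_exp]
        nlinarith
      have h₃ : 0 < Real.exp (k * b) - Real.exp (k * a) := by
        rw [sub_pos, Real.exp_lt_exp]
        nlinarith
      -- The two coefficients make the convex sum take equal values at `a` and `b`; that common
      -- value is `α₂`.
      refine ⟨Real.exp (-(l * a)) - Real.exp (-(l * b)),
        (Real.exp (-(l * a)) - Real.exp (-(l * b))) * Real.exp (k * a) +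
          (Real.exp (k * b) - Real.exp (k * a)) * Real.exp (-(l * a)),
        Real.exp (k * b) - Real.exp (k * a), a, b, h₁.le, by positivity, h₃.le, ?_⟩
      have hbeq : (Real.exp (-(l * a)) - Real.exp (-(l * b))) * Real.exp (k * b) +
          (Real.exp (k * b) - Real.exp (k * a)) * Real.exp (-(l * b)) =
          (Real.exp (-(l * a)) - Real.exp (-(l * b))) * Real.exp (k * a) +
          (Real.exp (k * b) - Real.exp (k * a)) * Real.exp (-(l * a)) := by ring
      refine fun u hua hub => ⟨fun hu => ?_, fun hu hu0 => ?_⟩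
      · have hau : a < u := lt_of_le_of_ne (csInf_le hbelow hu) hua.symm
        have hub' : u < b := lt_of_le_of_ne (le_csSup hab hu) hub
        exact exp_add_exp_lt_of_mem_Ioo h₁ h₃ hk ⟨hau, hub'⟩ le_rfl hbeq.le
      · rcases lt_or_gt_of_ne hua with h | h
        · by_contra! hcon
          have := exp_add_exp_lt_of_mem_Ioo h₁ h₃ hk ⟨h, hlt⟩ hcon hbeq.le
          exact lt_irrefl _ this
        · rcases lt_or_gt_of_ne hub with h' | h'
          · obtain ⟨x, hx, hxu⟩ := exists_lt_of_csInf_lt hne h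
            obtain ⟨y, hy, huy⟩ := exists_lt_of_lt_csSup hne h'
            exact absurd (hJ.out hx hy ⟨hxu.le, huy.le⟩) hu
          · by_contra! hcon
            have := exp_add_exp_lt_of_mem_Ioo h₁ h₃ hk ⟨hlt, h'⟩ le_rfl hcon
            exact lt_irrefl _ (hbeq.symm.trans_lt this)
    · set a := sInf J
      -- Here `J` has at most one point. The coefficients give the convex sum its minimum `l + k` at
      -- `a`, so it exceeds `α₂` everywhere else.
      refine ⟨l * Real.exp (-(k * a)), l + k, k * Real.exp (l * a), a, a, by positivity,
        by positivity, by positivity, fun u hu _ => ⟨fun huJ => ?_, fun _ _ => ?_⟩⟩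
      · exact absurd (le_antisymm ((le_csSup hab huJ).trans (not_lt.1 hlt)) (csInf_le hbelow huJ)) hu
      · have e1 : l * Real.exp (-(k * a)) * Real.exp (k * u) = l * Real.exp (k * (u - a)) := by
          rw [mul_assoc, ← Real.exp_add]
          ring_nf
        have e2 : k * Real.exp (l * a) * Real.exp (-(l * u)) = k * Real.exp (-(l * (u - a))) := by
          rw [mul_assoc, ← Real.exp_add]
          ring_nf
        rw [e1, e2]
        have hne : u - a ≠ 0 := sub_ne_zero.2 hu
        have h1 := Real.add_one_lt_exp (mul_ne_zero hk.ne' hne)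
        have h2 := Real.add_one_lt_exp (neg_ne_zero.2 (mul_ne_zero hl.ne' hne))
        nlinarith
  · have hne : J.Nonempty := by
      by_contra h
      rw [not_nonempty_iff_eq_empty] at h
      exact hab (h ▸ bddAbove_empty)
    set a := sInf J
    -- An unbounded `J` is a half-line up to its endpoint, and one decreasing exponential crossing
    -- its value at `a` suffices.
    refine ⟨0, Real.exp (-(l * a)), 1, a, a, le_rfl, by positivity, zero_le_one,
      fun u hu _ => ⟨fun huJ => ?_, fun huJ _ => ?_⟩⟩
    · have hau : a < u := lt_of_le_of_ne (csInf_le hbelow huJ) hu.symm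
      rw [zero_mul, zero_add, one_mul, Real.exp_lt_exp]
      nlinarith
    · have hau : u < a := by
        refine lt_of_le_of_ne (not_lt.1 fun h => huJ ?_) hu
        obtain ⟨x, hx, hxu⟩ := exists_lt_of_csInf_lt hne h
        obtain ⟨y, hy, huy⟩ := not_bddAbove_iff.1 hab u
        exact hJ.out hx hy ⟨hxu.le, huy.le⟩
      rw [zero_mul, zero_add, one_mul, Real.exp_lt_exp]
      nlinarith

/-- The integral of `exp (-s / x) * G x` over `x > 0`. -/
noncomputable def expMix (G : ℝ → ℝ) (s : ℝ) : ℝ≥0∞ :=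
  ∫⁻ x in Ioi (0 : ℝ), ENNReal.ofReal (Real.exp (-(s / x)) * G x)

theorem aemeasurable_expMix {G : ℝ → ℝ} (hG : AEMeasurable G (volume.restrict (Ioi (0 : ℝ))))
    (s : ℝ) : AEMeasurable (fun x => ENNReal.ofReal (Real.exp (-(s / x)) * G x))
      (volume.restrict (Ioi (0 : ℝ))) := by
  have h : Measurable (fun x : ℝ => Real.exp (-(s / x))) := by fun_prop
  exact (h.aemeasurable.mul hG).ennreal_ofReal

theorem ofReal_mul_expMix {G : ℝ → ℝ} (hG : AEMeasurable G (volume.restrict (Ioi (0 : ℝ))))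
    {α : ℝ} (hα : 0 ≤ α) (s : ℝ) :
    ENNReal.ofReal α * expMix G s =
      ∫⁻ x in Ioi (0 : ℝ), ENNReal.ofReal (α * (Real.exp (-(s / x)) * G x)) := by
  rw [expMix, ← lintegral_const_mul'' _ (aemeasurable_expMix hG s)]
  simp_rw [ENNReal.ofReal_mul hα]

/-- Differences are kept as sums on both sides of an inequality, so that infinite transforms cause
no trouble. -/
theorem lintegral_ofReal_add_three {G₁ G₂ G₃ : ℝ → ℝ} {ν : Measure ℝ}
    (h₁ : AEMeasurable G₁ ν) (h₂ : AEMeasurable G₂ ν)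
    (hn₁ : ∀ᵐ x ∂ν, 0 ≤ G₁ x) (hn₂ : ∀ᵐ x ∂ν, 0 ≤ G₂ x) (hn₃ : ∀ᵐ x ∂ν, 0 ≤ G₃ x) :
    ∫⁻ x, ENNReal.ofReal (G₁ x) ∂ν + ∫⁻ x, ENNReal.ofReal (G₂ x) ∂ν +
      ∫⁻ x, ENNReal.ofReal (G₃ x) ∂ν = ∫⁻ x, ENNReal.ofReal (G₁ x + G₂ x + G₃ x) ∂ν := by
  have h₁₂ : AEMeasurable (fun x => ENNReal.ofReal (G₁ x) + ENNReal.ofReal (G₂ x)) ν :=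
    h₁.ennreal_ofReal.add h₂.ennreal_ofReal
  rw [← lintegral_add_left' h₁.ennreal_ofReal, ← lintegral_add_left' h₁₂]
  refine lintegral_congr_ae ?_
  filter_upwards [hn₁, hn₂, hn₃] with x a b c
  rw [ENNReal.ofReal_add (add_nonneg a b) c, ENNReal.ofReal_add a b]

/-- Integrating a sign condition on `q (1 / x) * (G₁ x - G₂ x)`, where `q` is a combination of
exponentials. -/
theorem expMix_compare {G₁ G₂ : ℝ → ℝ} (hm₁ : AEMeasurable G₁ (volume.restrict (Ioi (0 : ℝ))))
    (hm₂ : AEMeasurable G₂ (volume.restrict (Ioi (0 : ℝ))))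
    (hn₁ : ∀ x ∈ Ioi (0 : ℝ), 0 ≤ G₁ x) (hn₂ : ∀ x ∈ Ioi (0 : ℝ), 0 ≤ G₂ x)
    {α₁ α₂ α₃ s₁ s₂ s₃ : ℝ} (h₁ : 0 ≤ α₁) (h₂ : 0 ≤ α₂) (h₃ : 0 ≤ α₃)
    (hsign : ∀ᵐ x ∂(volume.restrict (Ioi (0 : ℝ))),
      (α₁ * Real.exp (-(s₁ / x)) + α₃ * Real.exp (-(s₃ / x)) < α₂ * Real.exp (-(s₂ / x)) ∧
        G₂ x ≤ G₁ x) ∨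
      (α₂ * Real.exp (-(s₂ / x)) < α₁ * Real.exp (-(s₁ / x)) + α₃ * Real.exp (-(s₃ / x)) ∧
        G₁ x ≤ G₂ x)) :
    ENNReal.ofReal α₁ * expMix G₁ s₁ + ENNReal.ofReal α₃ * expMix G₁ s₃ +
        ENNReal.ofReal α₂ * expMix G₂ s₂ ≤
      ENNReal.ofReal α₁ * expMix G₂ s₁ + ENNReal.ofReal α₃ * expMix G₂ s₃ +
        ENNReal.ofReal α₂ * expMix G₁ s₂ ∧
    (¬ G₁ =ᵐ[volume.restrict (Ioi (0 : ℝ))] G₂ →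
      ENNReal.ofReal α₁ * expMix G₂ s₁ + ENNReal.ofReal α₃ * expMix G₂ s₃ +
        ENNReal.ofReal α₂ * expMix G₁ s₂ ≠ ∞ →
      ENNReal.ofReal α₁ * expMix G₁ s₁ + ENNReal.ofReal α₃ * expMix G₁ s₃ +
        ENNReal.ofReal α₂ * expMix G₂ s₂ <
      ENNReal.ofReal α₁ * expMix G₂ s₁ + ENNReal.ofReal α₃ * expMix G₂ s₃ +
        ENNReal.ofReal α₂ * expMix G₁ s₂) := by
  have hmeas : ∀ {G : ℝ → ℝ} (_ : AEMeasurable G (volume.restrict (Ioi (0 : ℝ)))) (α s : ℝ),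
      AEMeasurable (fun x => α * (Real.exp (-(s / x)) * G x)) (volume.restrict (Ioi (0 : ℝ))) := by
    intro G hG α s
    have h : Measurable (fun x : ℝ => Real.exp (-(s / x))) := by fun_prop
    exact (h.aemeasurable.mul hG).const_mul α
  have hnn : ∀ {G : ℝ → ℝ} (_ : ∀ x ∈ Ioi (0 : ℝ), 0 ≤ G x) {α : ℝ} (_ : 0 ≤ α) (s : ℝ),
      ∀ᵐ x ∂(volume.restrict (Ioi (0 : ℝ))), 0 ≤ α * (Real.exp (-(s / x)) * G x) := by
    intro G hG α hα s
    filter_upwards [ae_restrict_mem measurableSet_Ioi] with x hx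
    have := hG x hx
    positivity
  simp only [ofReal_mul_expMix hm₁ h₁, ofReal_mul_expMix hm₁ h₂, ofReal_mul_expMix hm₁ h₃,
    ofReal_mul_expMix hm₂ h₁, ofReal_mul_expMix hm₂ h₂, ofReal_mul_expMix hm₂ h₃]
  rw [lintegral_ofReal_add_three (hmeas hm₁ _ _) (hmeas hm₁ _ _) (hnn hn₁ h₁ _) (hnn hn₁ h₃ _)
      (hnn hn₂ h₂ _),
    lintegral_ofReal_add_three (hmeas hm₂ _ _) (hmeas hm₂ _ _) (hnn hn₂ h₁ _) (hnn hn₂ h₃ _)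
      (hnn hn₁ h₂ _)]
  have hRm := (((hmeas hm₂ α₁ s₁).add (hmeas hm₂ α₃ s₃)).add (hmeas hm₁ α₂ s₂)).ennreal_ofReal
  have hle : ∀ᵐ x ∂(volume.restrict (Ioi (0 : ℝ))),
      ENNReal.ofReal (α₁ * (Real.exp (-(s₁ / x)) * G₁ x) + α₃ * (Real.exp (-(s₃ / x)) * G₁ x) +
        α₂ * (Real.exp (-(s₂ / x)) * G₂ x)) ≤
      ENNReal.ofReal (α₁ * (Real.exp (-(s₁ / x)) * G₂ x) + α₃ * (Real.exp (-(s₃ / x)) * G₂ x) +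
        α₂ * (Real.exp (-(s₂ / x)) * G₁ x)) := by
    filter_upwards [hsign] with x hx
    refine ENNReal.ofReal_le_ofReal ?_
    -- Right minus left is the product of the exponential combination and `G₂ - G₁`, which have
    -- equal signs.
    rcases hx with ⟨hq, hG⟩ | ⟨hq, hG⟩ <;> nlinarith [mul_nonneg (sub_nonneg.2 hq.le) (sub_nonneg.2 hG)]
  refine ⟨lintegral_mono_ae hle, fun hne hfin => ?_⟩
  refine lintegral_strict_mono_of_ae_le_of_frequently_ae_lt hRm
    (ne_top_of_le_ne_top hfin (lintegral_mono_ae hle)) hle ?_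
  intro hev
  refine hne ?_
  filter_upwards [hev, hsign, ae_restrict_mem measurableSet_Ioi] with x hx hs hx0
  have hg1 := hn₁ x hx0
  have hg2 := hn₂ x hx0
  have hx := not_not.1 hx
  rw [ENNReal.ofReal_eq_ofReal_iff (by positivity) (by positivity)] at hx
  have h0 : (α₁ * Real.exp (-(s₁ / x)) + α₃ * Real.exp (-(s₃ / x)) - α₂ * Real.exp (-(s₂ / x))) *
      (G₁ x - G₂ x) = 0 := by linear_combination hx
  rcases mul_eq_zero.1 h0 with h | h
  · rcases hs with ⟨hq, _⟩ | ⟨hq, _⟩ <;> linarith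
  · linarith

/-- If `G₁ - G₂` has the sign pattern `-, +, -` on `(0, ∞)`, the same holds for the transforms. -/
theorem expMix_three_point {G₁ G₂ : ℝ → ℝ}
    (hm₁ : AEMeasurable G₁ (volume.restrict (Ioi (0 : ℝ))))
    (hm₂ : AEMeasurable G₂ (volume.restrict (Ioi (0 : ℝ))))
    (hn₁ : ∀ x ∈ Ioi (0 : ℝ), 0 ≤ G₁ x) (hn₂ : ∀ x ∈ Ioi (0 : ℝ), 0 ≤ G₂ x)
    {I : Set ℝ} (hI : I.OrdConnected) (hin : ∀ x ∈ Ioi (0 : ℝ), x ∈ I → G₂ x ≤ G₁ x)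
    (hout : ∀ x ∈ Ioi (0 : ℝ), x ∉ I → G₁ x ≤ G₂ x)
    {s₁ s₂ s₃ : ℝ} (h12 : s₁ < s₂) (h23 : s₂ < s₃) :
    ∃ α₁ α₂ α₃ : ℝ, 0 < α₂ ∧
    ENNReal.ofReal α₁ * expMix G₁ s₁ + ENNReal.ofReal α₃ * expMix G₁ s₃ +
        ENNReal.ofReal α₂ * expMix G₂ s₂ ≤
      ENNReal.ofReal α₁ * expMix G₂ s₁ + ENNReal.ofReal α₃ * expMix G₂ s₃ +
        ENNReal.ofReal α₂ * expMix G₁ s₂ ∧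
    (¬ G₁ =ᵐ[volume.restrict (Ioi (0 : ℝ))] G₂ →
      ENNReal.ofReal α₁ * expMix G₂ s₁ + ENNReal.ofReal α₃ * expMix G₂ s₃ +
        ENNReal.ofReal α₂ * expMix G₁ s₂ ≠ ∞ →
      ENNReal.ofReal α₁ * expMix G₁ s₁ + ENNReal.ofReal α₃ * expMix G₁ s₃ +
        ENNReal.ofReal α₂ * expMix G₂ s₂ <
      ENNReal.ofReal α₁ * expMix G₂ s₁ + ENNReal.ofReal α₃ * expMix G₂ s₃ +
        ENNReal.ofReal α₂ * expMix G₁ s₂) := by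
  -- Inversion `u = 1/x` turns the kernel into exponentials in `u` and preserves intervals. Dividing
  -- by `exp(-s₂ u)` leaves rates `s₂ - s₁` and `s₃ - s₂`.
  have hJ : {u : ℝ | 0 < u ∧ u⁻¹ ∈ I}.OrdConnected := by
    refine ⟨fun u hu v hv z hz => ?_⟩
    have hz0 : 0 < z := hu.1.trans_le hz.1
    exact ⟨hz0, hI.out hv.2 hu.2 ⟨inv_anti₀ hz0 hz.2, inv_anti₀ hu.1 hz.1⟩⟩
  obtain ⟨α₁, α₂, α₃, a, b, h₁, h₂, h₃, hs⟩ := exists_exp_sign hJ (fun u hu => hu.1)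
    (sub_pos.2 h12) (sub_pos.2 h23)
  refine ⟨α₁, α₂, α₃, h₂, expMix_compare hm₁ hm₂ hn₁ hn₂ h₁ h₂.le h₃ ?_⟩
  have hna : ∀ᵐ x : ℝ, x ≠ a⁻¹ := by simp [ae_iff]
  have hnb : ∀ᵐ x : ℝ, x ≠ b⁻¹ := by simp [ae_iff]
  filter_upwards [ae_restrict_mem measurableSet_Ioi, ae_restrict_of_ae hna, ae_restrict_of_ae hnb]
    with x hx hxa hxb
  have hx0 : (0 : ℝ) < x := hx
  have hxa' : x⁻¹ ≠ a := fun h => hxa (by rw [← h, inv_inv])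
  have hxb' : x⁻¹ ≠ b := fun h => hxb (by rw [← h, inv_inv])
  obtain ⟨hJin, hJout⟩ := hs x⁻¹ hxa' hxb'
  have e1 : Real.exp (-(s₁ / x)) = Real.exp (-(s₂ / x)) * Real.exp ((s₂ - s₁) * x⁻¹) := by
    rw [← Real.exp_add]
    ring_nf
  have e3 : Real.exp (-(s₃ / x)) = Real.exp (-(s₂ / x)) * Real.exp (-((s₃ - s₂) * x⁻¹)) := by
    rw [← Real.exp_add]
    ring_nf
  have hpos := Real.exp_pos (-(s₂ / x))
  rw [e1, e3]
  by_cases hxI : x ∈ I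
  · refine Or.inl ⟨?_, hin x hx hxI⟩
    have := hJin ⟨inv_pos.2 hx0, by rwa [inv_inv]⟩
    nlinarith
  · refine Or.inr ⟨?_, hout x hx hxI⟩
    have := hJout (fun h => hxI (by simpa using h.2)) (inv_pos.2 hx0)
    nlinarith

/-- If `G₁ - G₂` has the sign pattern `+, -` on `(0, ∞)`, the same holds for the transforms. -/
theorem expMix_two_point {G₁ G₂ : ℝ → ℝ}
    (hm₁ : AEMeasurable G₁ (volume.restrict (Ioi (0 : ℝ))))
    (hm₂ : AEMeasurable G₂ (volume.restrict (Ioi (0 : ℝ))))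
    (hn₁ : ∀ x ∈ Ioi (0 : ℝ), 0 ≤ G₁ x) (hn₂ : ∀ x ∈ Ioi (0 : ℝ), 0 ≤ G₂ x)
    {I : Set ℝ} (hI : ∀ x ∈ I, ∀ y, 0 < y → y ≤ x → y ∈ I)
    (hin : ∀ x ∈ Ioi (0 : ℝ), x ∈ I → G₂ x ≤ G₁ x)
    (hout : ∀ x ∈ Ioi (0 : ℝ), x ∉ I → G₁ x ≤ G₂ x)
    {s₂ s₃ : ℝ} (h23 : s₂ < s₃) (hne : ¬ G₁ =ᵐ[volume.restrict (Ioi (0 : ℝ))] G₂)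
    (hfin₁ : expMix G₁ s₂ ≠ ∞) (hfin₂ : expMix G₂ s₃ ≠ ∞) :
    ∃ α : ℝ, expMix G₁ s₃ + ENNReal.ofReal α * expMix G₂ s₂ <
      expMix G₂ s₃ + ENNReal.ofReal α * expMix G₁ s₂ := by
  suffices h : ∃ α a : ℝ, 0 ≤ α ∧ ∀ u, u ≠ a → 0 < u →
      (u⁻¹ ∈ I → Real.exp (-((s₃ - s₂) * u)) < α) ∧
      (u⁻¹ ∉ I → α < Real.exp (-((s₃ - s₂) * u))) by
    obtain ⟨α, a, hα, hs⟩ := h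
    refine ⟨α, ?_⟩
    -- The first point is switched off by `α₁ = 0`, so its location is immaterial.
    have hc := (expMix_compare hm₁ hm₂ hn₁ hn₂ (s₁ := 0) (s₂ := s₂) (s₃ := s₃) le_rfl hα
      zero_le_one ?_).2 hne
    · simp only [ENNReal.ofReal_zero, zero_mul, zero_add, ENNReal.ofReal_one, one_mul] at hc
      exact hc (ENNReal.add_ne_top.2 ⟨hfin₂, ENNReal.mul_ne_top ENNReal.ofReal_ne_top hfin₁⟩)
    have hna : ∀ᵐ x : ℝ, x ≠ a⁻¹ := by simp [ae_iff]
    filter_upwards [ae_restrict_mem measurableSet_Ioi, ae_restrict_of_ae hna] with x hx hxa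
    have hx0 : (0 : ℝ) < x := hx
    have hxa' : x⁻¹ ≠ a := fun h => hxa (by rw [← h, inv_inv])
    obtain ⟨hJin, hJout⟩ := hs x⁻¹ hxa' (inv_pos.2 hx0)
    rw [inv_inv] at hJin hJout
    have e3 : Real.exp (-(s₃ / x)) = Real.exp (-(s₂ / x)) * Real.exp (-((s₃ - s₂) * x⁻¹)) := by
      rw [← Real.exp_add]
      ring_nf
    have hpos := Real.exp_pos (-(s₂ / x))
    rw [e3]
    by_cases hxI : x ∈ I
    · refine Or.inl ⟨?_, hin x hx hxI⟩
      have := hJin hxI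
      nlinarith
    · refine Or.inr ⟨?_, hout x hx hxI⟩
      have := hJout hxI
      nlinarith
  -- An initial segment in `x` is a final segment in `u = 1/x`; the decreasing exponential crosses
  -- `α` at its left endpoint.
  set J : Set ℝ := {u : ℝ | 0 < u ∧ u⁻¹ ∈ I}
  have hl : 0 < s₃ - s₂ := sub_pos.2 h23
  rcases J.eq_empty_or_nonempty with hJ | hJ
  · refine ⟨0, 0, le_rfl, fun u _ hu0 => ⟨fun hu => ?_, fun _ => Real.exp_pos _⟩⟩
    have : u ∈ J := ⟨hu0, hu⟩
    simp [hJ] at this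
  · have hbelow : BddBelow J := ⟨0, fun x hx => hx.1.le⟩
    refine ⟨Real.exp (-((s₃ - s₂) * sInf J)), sInf J, (Real.exp_pos _).le, fun u hu hu0 =>
      ⟨fun huI => ?_, fun huI => ?_⟩⟩
    · have : sInf J < u := lt_of_le_of_ne (csInf_le hbelow ⟨hu0, huI⟩) hu.symm
      rw [Real.exp_lt_exp]
      nlinarith
    · have : u < sInf J := by
        refine lt_of_le_of_ne (not_lt.1 fun h => huI ?_) hu
        obtain ⟨x, hx, hxu⟩ := exists_lt_of_csInf_lt hJ h
        exact hI _ hx.2 _ (inv_pos.2 hu0) (inv_anti₀ hx.1 hxu.le)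
      rw [Real.exp_lt_exp]
      nlinarith

/-! ### The explicit transform of the comparison kernels -/

theorem sqrt_diff_surjOn {a r : ℝ} (ha : 0 < a) (hr : 0 < r) :
    (fun x : ℝ => a * Real.sqrt x - r / Real.sqrt x) '' Ioi 0 = univ := by
  refine eq_univ_of_forall fun t => ?_
  -- With `v = √x` the equation is `a v² - t v - r = 0`; `d` is the root of its discriminant.
  set d := Real.sqrt (t ^ 2 + 4 * a * r) with hd
  have hd2 : d ^ 2 = t ^ 2 + 4 * a * r := Real.sq_sqrt (by positivity)
  have hdt : |t| < d := by
    rw [hd, ← Real.sqrt_sq_eq_abs]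
    exact Real.sqrt_lt_sqrt (sq_nonneg t) (by nlinarith [mul_pos ha hr])
  have hv : 0 < (t + d) / (2 * a) := div_pos (by linarith [neg_abs_le t]) (by positivity)
  refine ⟨((t + d) / (2 * a)) ^ 2, pow_pos hv 2, ?_⟩
  have : t + d ≠ 0 := by linarith [neg_abs_le t]
  simp only [Real.sqrt_sq hv.le]
  field_simp
  linear_combination hd2

theorem sqrt_diff_injOn {a r : ℝ} (ha : 0 < a) (hr : 0 ≤ r) :
    InjOn (fun x : ℝ => a * Real.sqrt x - r / Real.sqrt x) (Ioi 0) := by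
  refine StrictMonoOn.injOn fun x hx y hy hxy => ?_
  have hx0 : (0 : ℝ) < x := hx
  have h1 : Real.sqrt x < Real.sqrt y := Real.sqrt_lt_sqrt hx0.le hxy
  have h2 : r / Real.sqrt y ≤ r / Real.sqrt x :=
    div_le_div_of_nonneg_left hr (Real.sqrt_pos.2 hx0) h1.le
  have h3 := mul_lt_mul_of_pos_left h1 ha
  linarith

theorem hasDerivAt_sqrt_diff (a r : ℝ) {x : ℝ} (hx : 0 < x) :
    HasDerivAt (fun x : ℝ => a * Real.sqrt x - r / Real.sqrt x)
      (a / (2 * Real.sqrt x) + r / (2 * x * Real.sqrt x)) x := by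
  have hs := Real.sqrt_pos.2 hx
  have h := Real.hasDerivAt_sqrt hx.ne'
  have h2 := (h.const_mul a).sub ((hasDerivAt_const x r).div h hs.ne')
  refine h2.congr_deriv ?_
  rw [Real.sq_sqrt hx.le]
  field_simp
  ring

/-- Substitute `t = a√x - r/√x`. For `r > 0` this maps onto the whole line and its derivative has
two terms; the inversion `x ↦ (r/a)²/x` shows that they contribute equally, so each is half the
Gaussian integral. For `r = 0` only one term remains and the image is a half-line. -/
theorem lintegral_sqrt_inv_mul_exp_sq {a r : ℝ} (ha : 0 < a) (hr : 0 ≤ r) :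
    ∫⁻ x in Ioi (0 : ℝ), ENNReal.ofReal
      ((Real.sqrt x)⁻¹ * Real.exp (-(a * Real.sqrt x - r / Real.sqrt x) ^ 2 / 2)) =
    ENNReal.ofReal (Real.sqrt (2 * Real.pi) / a) := by
  have hgauss : Integrable (fun t : ℝ => Real.exp (-(1 / 2) * t ^ 2)) :=
    integrable_exp_neg_mul_sq (by norm_num)
  have hpi : Real.pi / (1 / 2) = 2 * Real.pi := by ring
  rcases hr.eq_or_lt with rfl | hr
  · have himg : (fun x : ℝ => a * Real.sqrt x - 0 / Real.sqrt x) '' Ioi 0 = Ioi 0 := by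
      ext t
      constructor
      · rintro ⟨x, hx, rfl⟩
        have := Real.sqrt_pos.2 hx
        simp only [zero_div, sub_zero, mem_Ioi]
        positivity
      · intro ht
        have ht' : 0 < t / a := div_pos ht ha
        refine ⟨(t / a) ^ 2, pow_pos ht' 2, ?_⟩
        simp only [zero_div, sub_zero, Real.sqrt_sq ht'.le]
        field_simp
    have h := lintegral_image_eq_lintegral_abs_deriv_mul measurableSet_Ioi
      (fun x hx => (hasDerivAt_sqrt_diff a 0 hx).hasDerivWithinAt) (sqrt_diff_injOn ha le_rfl)
      (fun t => ENNReal.ofReal (Real.exp (-(1 / 2) * t ^ 2)))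
    rw [himg, ← ofReal_integral_eq_lintegral_ofReal hgauss.integrableOn
      (ae_of_all _ fun _ => (Real.exp_pos _).le), integral_gaussian_Ioi, hpi] at h
    have h2 : ENNReal.ofReal (a / 2) * ∫⁻ x in Ioi (0 : ℝ), ENNReal.ofReal
      ((Real.sqrt x)⁻¹ * Real.exp (-(a * Real.sqrt x - 0 / Real.sqrt x) ^ 2 / 2)) =
        ENNReal.ofReal (a / 2) * ENNReal.ofReal (Real.sqrt (2 * Real.pi) / a) := by
      rw [← ENNReal.ofReal_mul (by positivity), ← lintegral_const_mul _ (by fun_prop)]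
      rw [show a / 2 * (Real.sqrt (2 * Real.pi) / a) = Real.sqrt (2 * Real.pi) / 2 by field_simp, h]
      refine setLIntegral_congr_fun measurableSet_Ioi fun x hx => ?_
      have hx0 : (0 : ℝ) < x := hx
      have hs := Real.sqrt_pos.2 hx0
      rw [← ENNReal.ofReal_mul (by positivity), ← ENNReal.ofReal_mul (by positivity),
        abs_of_nonneg (by positivity)]
      congr 1
      rw [zero_div (2 * x * Real.sqrt x), add_zero, ← mul_assoc]
      congr 1
      · field_simp
      · ring_nf
    exact (ENNReal.mul_right_inj (by simpa using ha) ENNReal.ofReal_ne_top).1 h2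
  set E : ℝ → ℝ := fun x => Real.exp (-(a * Real.sqrt x - r / Real.sqrt x) ^ 2 / 2) with hE
  have hEm : Measurable E := by fun_prop
  have hEpos : ∀ x, 0 < E x := fun x => Real.exp_pos _
  set U := ∫⁻ x in Ioi (0 : ℝ), ENNReal.ofReal (a / (2 * Real.sqrt x) * E x) with hU
  set W := ∫⁻ x in Ioi (0 : ℝ), ENNReal.ofReal (r / (2 * x * Real.sqrt x) * E x) with hW
  have hUW : U + W = ENNReal.ofReal (Real.sqrt (2 * Real.pi)) := by
    have h := lintegral_image_eq_lintegral_abs_deriv_mul measurableSet_Ioi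
      (fun x hx => (hasDerivAt_sqrt_diff a r hx).hasDerivWithinAt) (sqrt_diff_injOn ha hr.le)
      (fun t => ENNReal.ofReal (Real.exp (-(1 / 2) * t ^ 2)))
    rw [sqrt_diff_surjOn ha hr, Measure.restrict_univ,
      ← ofReal_integral_eq_lintegral_ofReal hgauss
      (ae_of_all _ fun _ => (Real.exp_pos _).le), integral_gaussian, hpi] at h
    rw [h, hU, hW, ← lintegral_add_left (by fun_prop)]
    refine setLIntegral_congr_fun measurableSet_Ioi fun x hx => ?_
    have hx0 : (0 : ℝ) < x := hx
    have hs := Real.sqrt_pos.2 hx0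
    have := hEpos x
    rw [← ENNReal.ofReal_mul (by positivity), ← ENNReal.ofReal_add (by positivity) (by positivity),
      abs_of_nonneg (by positivity), ← add_mul]
    have : Real.exp (-(1 / 2) * (a * Real.sqrt x - r / Real.sqrt x) ^ 2) = E x := by
      simp only [hE]
      congr 1
      ring
    rw [this]
  -- The inversion flips the sign of `a√x - r/√x`, leaving `E` invariant, and exchanges the two
  -- weights.
  have hUeqW : U = W := by
    have himg : (fun x : ℝ => (r / a) ^ 2 / x) '' Ioi 0 = Ioi 0 := by
      ext t
      constructor
      · rintro ⟨x, hx, rfl⟩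
        have hx0 : (0 : ℝ) < x := hx
        simp only [mem_Ioi]
        positivity
      · intro ht
        have ht0 : (0 : ℝ) < t := ht
        exact ⟨(r / a) ^ 2 / t, by simp only [mem_Ioi]; positivity, by field_simp⟩
    have hinj : InjOn (fun x : ℝ => (r / a) ^ 2 / x) (Ioi 0) := by
      intro x hx y hy hxy
      have hx0 : (0 : ℝ) < x := hx
      have hy0 : (0 : ℝ) < y := hy
      field_simp at hxy
      exact hxy.symm
    have hder : ∀ x ∈ Ioi (0 : ℝ), HasDerivWithinAt (fun x : ℝ => (r / a) ^ 2 / x)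
        (-((r / a) ^ 2 / x ^ 2)) (Ioi 0) x := by
      intro x hx
      have hx0 : (0 : ℝ) < x := hx
      have := ((hasDerivAt_const x ((r / a) ^ 2)).div (hasDerivAt_id x) hx0.ne').hasDerivWithinAt
        (s := Ioi 0)
      refine this.congr_deriv ?_
      simp [neg_div]
    have h := lintegral_image_eq_lintegral_abs_deriv_mul measurableSet_Ioi hder hinj
      (fun x => ENNReal.ofReal (a / (2 * Real.sqrt x) * E x))
    rw [himg] at h
    rw [hU, h, hW]
    refine setLIntegral_congr_fun measurableSet_Ioi fun x hx => ?_
    have hx0 : (0 : ℝ) < x := hx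
    have hs := Real.sqrt_pos.2 hx0
    have hsq : Real.sqrt ((r / a) ^ 2 / x) = r / a / Real.sqrt x := by
      rw [Real.sqrt_div' _ hx0.le, Real.sqrt_sq (by positivity)]
    have hEE : E ((r / a) ^ 2 / x) = E x := by
      simp only [hE, hsq]
      congr 1
      field_simp
      ring
    have := hEpos x
    rw [hEE, ← ENNReal.ofReal_mul (by positivity), abs_neg, abs_of_nonneg (by positivity), hsq,
      ← mul_assoc]
    congr 2
    have hxx : x ^ 2 = Real.sqrt x ^ 2 * x := by rw [Real.sq_sqrt hx0.le]; ring
    rw [hxx]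
    field_simp
  rw [← hUeqW, ← two_mul] at hUW
  have hUI : U = ENNReal.ofReal (a / 2) * ∫⁻ x in Ioi (0 : ℝ), ENNReal.ofReal
      ((Real.sqrt x)⁻¹ * E x) := by
    rw [← lintegral_const_mul _ (by fun_prop), hU]
    refine lintegral_congr fun x => ?_
    rw [← ENNReal.ofReal_mul (by positivity)]
    congr 1
    field_simp
  have h2 : (2 : ℝ≥0∞) * ENNReal.ofReal (a / 2) = ENNReal.ofReal a := by
    rw [show (2 : ℝ≥0∞) = ENNReal.ofReal 2 by simp, ← ENNReal.ofReal_mul (by norm_num)]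
    congr 1
    ring
  rw [hUI, ← mul_assoc, h2] at hUW
  refine (ENNReal.mul_right_inj (a := ENNReal.ofReal a) (by simpa using ha)
    ENNReal.ofReal_ne_top).1 ?_
  rw [hUW, ← ENNReal.ofReal_mul ha.le]
  congr 1
  field_simp

/-- The functions whose transforms are exponential in `√(2 s)`. -/
noncomputable def expKernel (c a x : ℝ) : ℝ :=
  c * ((Real.sqrt x)⁻¹ * Real.exp (-(a ^ 2 * x / 2)))

theorem measurable_expKernel (c a : ℝ) : Measurable (expKernel c a) := by
  unfold expKernel
  fun_prop

theorem expKernel_nonneg {c : ℝ} (hc : 0 ≤ c) (a x : ℝ) : 0 ≤ expKernel c a x := by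
  unfold expKernel
  positivity

/-- Completing the square as `(a√x - r/√x)²` pulls out the factor `exp(-a r)`. -/
theorem expMix_expKernel {c a r : ℝ} (hc : 0 ≤ c) (ha : 0 < a) (hr : 0 ≤ r) :
    expMix (expKernel c a) (r ^ 2 / 2) =
      ENNReal.ofReal (c * (Real.sqrt (2 * Real.pi) / a) * Real.exp (-(a * r))) := by
  have h := lintegral_sqrt_inv_mul_exp_sq ha hr
  have h2 : expMix (expKernel c a) (r ^ 2 / 2) = ENNReal.ofReal (c * Real.exp (-(a * r))) *
      ∫⁻ x in Ioi (0 : ℝ), ENNReal.ofReal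
      ((Real.sqrt x)⁻¹ * Real.exp (-(a * Real.sqrt x - r / Real.sqrt x) ^ 2 / 2)) := by
    rw [← lintegral_const_mul _ (by fun_prop)]
    refine setLIntegral_congr_fun measurableSet_Ioi fun x hx => ?_
    have hx0 : (0 : ℝ) < x := hx
    have hs := Real.sqrt_pos.2 hx0
    rw [← ENNReal.ofReal_mul (by positivity), expKernel]
    congr 1
    have : Real.exp (-(r ^ 2 / 2 / x)) * Real.exp (-(a ^ 2 * x / 2)) = Real.exp (-(a * r)) *
        Real.exp (-(a * Real.sqrt x - r / Real.sqrt x) ^ 2 / 2) := by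
      rw [← Real.exp_add, ← Real.exp_add]
      congr 1
      have e : (a * Real.sqrt x - r / Real.sqrt x) ^ 2 = a ^ 2 * x - 2 * a * r + r ^ 2 / x := by
        rw [sub_sq, mul_pow, div_pow, Real.sq_sqrt hx0.le]
        field_simp
      rw [e]
      ring
    linear_combination c * (Real.sqrt x)⁻¹ * this
  rw [h2, h, ← ENNReal.ofReal_mul (by positivity)]
  congr 1
  ring

/-! ### Monotonicity, continuity and decay of the transform -/

theorem expMix_anti {G : ℝ → ℝ} (hn : ∀ x ∈ Ioi (0 : ℝ), 0 ≤ G x) {s t : ℝ} (hst : s ≤ t) :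
    expMix G t ≤ expMix G s := by
  refine setLIntegral_mono' measurableSet_Ioi fun x hx => ENNReal.ofReal_le_ofReal ?_
  have hx0 : (0 : ℝ) < x := hx
  refine mul_le_mul_of_nonneg_right (Real.exp_le_exp.2 (neg_le_neg ?_)) (hn x hx)
  gcongr

theorem expMix_lt {G : ℝ → ℝ} (hm : AEMeasurable G (volume.restrict (Ioi (0 : ℝ))))
    (hn : ∀ x ∈ Ioi (0 : ℝ), 0 ≤ G x) (hne : ¬ G =ᵐ[volume.restrict (Ioi (0 : ℝ))] 0)
    {s t : ℝ} (hst : s < t) (hfin : expMix G t ≠ ∞) : expMix G t < expMix G s := by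
  refine lintegral_strict_mono_of_ae_le_of_frequently_ae_lt (aemeasurable_expMix hm s) hfin ?_ ?_
  · filter_upwards [ae_restrict_mem measurableSet_Ioi] with x hx
    have hx0 : (0 : ℝ) < x := hx
    refine ENNReal.ofReal_le_ofReal
      (mul_le_mul_of_nonneg_right (Real.exp_le_exp.2 (neg_le_neg ?_)) (hn x hx))
    gcongr
  · intro hev
    refine hne ?_
    filter_upwards [hev, ae_restrict_mem measurableSet_Ioi] with x hx hx0
    have hx0' : (0 : ℝ) < x := hx0
    have hg := hn x hx0
    have hx := not_not.1 hx
    rw [ENNReal.ofReal_eq_ofReal_iff (by positivity) (by positivity)] at hx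
    have hlt : Real.exp (-(t / x)) < Real.exp (-(s / x)) :=
      Real.exp_lt_exp.2 (neg_lt_neg (div_lt_div_of_pos_right hst hx0'))
    have : (Real.exp (-(s / x)) - Real.exp (-(t / x))) * G x = 0 := by linear_combination -hx
    rcases mul_eq_zero.1 this with h | h
    · linarith
    · exact h

theorem expMix_pos {G : ℝ → ℝ} (hm : AEMeasurable G (volume.restrict (Ioi (0 : ℝ))))
    (hn : ∀ x ∈ Ioi (0 : ℝ), 0 ≤ G x) (hne : ¬ G =ᵐ[volume.restrict (Ioi (0 : ℝ))] 0)
    (s : ℝ) : 0 < expMix G s := by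
  refine pos_iff_ne_zero.2 fun h0 => hne ?_
  rw [expMix, lintegral_eq_zero_iff' (aemeasurable_expMix hm s)] at h0
  filter_upwards [h0, ae_restrict_mem measurableSet_Ioi] with x hx hx0
  have hg := hn x hx0
  have h1 : Real.exp (-(s / x)) * G x ≤ 0 := ENNReal.ofReal_eq_zero.1 hx
  have h2 := Real.exp_pos (-(s / x))
  exact le_antisymm (by by_contra! h; exact absurd h1 (not_le.2 (mul_pos h2 h))) hg

/-- Dominated convergence, with the integrand at `s/2` as bound. The point `0` is excluded because
the transform may be infinite there. -/
theorem continuousAt_expMix {G : ℝ → ℝ} (hm : AEMeasurable G (volume.restrict (Ioi (0 : ℝ))))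
    (hn : ∀ x ∈ Ioi (0 : ℝ), 0 ≤ G x) (hfin : ∀ s, 0 < s → expMix G s ≠ ∞) {s : ℝ} (hs : 0 < s) :
    ContinuousAt (expMix G) s := by
  refine tendsto_lintegral_filter_of_dominated_convergence'
    (fun x => ENNReal.ofReal (Real.exp (-(s / 2 / x)) * G x))
    (Filter.Eventually.of_forall fun t => aemeasurable_expMix hm t) ?_ (hfin _ (half_pos hs)) ?_
  · filter_upwards [lt_mem_nhds (half_lt_self hs)] with t ht
    filter_upwards [ae_restrict_mem measurableSet_Ioi] with x hx
    have hx0 : (0 : ℝ) < x := hx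
    refine ENNReal.ofReal_le_ofReal
      (mul_le_mul_of_nonneg_right (Real.exp_le_exp.2 (neg_le_neg ?_)) (hn x hx))
    gcongr
  · refine ae_of_all _ fun x => ENNReal.tendsto_ofReal ?_
    have : Continuous fun t : ℝ => Real.exp (-(t / x)) * G x := by fun_prop
    exact this.tendsto s

/-- The transform at `r ^ 2 / 2`, exponentially tilted in `r`. -/
noncomputable def tilted (G : ℝ → ℝ) (d r : ℝ) : ℝ≥0∞ :=
  ENNReal.ofReal (Real.exp (d * r)) * expMix G (r ^ 2 / 2)

theorem tilted_pos {G : ℝ → ℝ} (hm : AEMeasurable G (volume.restrict (Ioi (0 : ℝ))))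
    (hn : ∀ x ∈ Ioi (0 : ℝ), 0 ≤ G x) (hne : ¬ G =ᵐ[volume.restrict (Ioi (0 : ℝ))] 0)
    (d r : ℝ) : 0 < tilted G d r :=
  ENNReal.mul_pos (by simpa using Real.exp_pos _) (expMix_pos hm hn hne _).ne'

theorem tilted_ne_top {G : ℝ → ℝ} (hfin : ∀ s, 0 < s → expMix G s ≠ ∞) (d : ℝ) {r : ℝ}
    (hr : 0 < r) : tilted G d r ≠ ∞ :=
  ENNReal.mul_ne_top ENNReal.ofReal_ne_top (hfin _ (by positivity))

theorem upperSemicontinuousOn_tilted {G : ℝ → ℝ}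
    (hm : AEMeasurable G (volume.restrict (Ioi (0 : ℝ))))
    (hn : ∀ x ∈ Ioi (0 : ℝ), 0 ≤ G x) (hfin : ∀ s, 0 < s → expMix G s ≠ ∞) (d : ℝ) :
    UpperSemicontinuousOn (tilted G d) (Ici 0) := by
  intro r hr
  have hexp : ∀ r : ℝ, Filter.Tendsto (fun r : ℝ => ENNReal.ofReal (Real.exp (d * r))) (nhds r)
      (nhds (ENNReal.ofReal (Real.exp (d * r)))) := by
    intro r
    refine ENNReal.tendsto_ofReal ?_
    have : Continuous fun r : ℝ => Real.exp (d * r) := by fun_prop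
    exact this.tendsto r
  rcases (mem_Ici.1 hr).eq_or_lt with rfl | hr0
  -- Only upper semicontinuity is needed at `0`, and it follows from monotonicity of the transform;
  -- it is vacuous if the value there is `∞`.
  · intro y hy
    have h1 : Filter.Tendsto (fun r : ℝ => ENNReal.ofReal (Real.exp (d * r)) * expMix G (0 ^ 2 / 2))
        (nhds 0) (nhds (tilted G d 0)) :=
      ENNReal.Tendsto.mul_const (hexp 0) (Or.inl (by simp))
    have h2 := h1.eventually_lt_const hy
    filter_upwards [mem_nhdsWithin_of_mem_nhds h2] with r' hr'
    refine lt_of_le_of_lt ?_ hr'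
    refine mul_le_mul_right (expMix_anti hn ?_) _
    have := sq_nonneg r'
    simp only [ne_eq, OfNat.ofNat_ne_zero, not_false_eq_true, zero_pow, zero_div]
    positivity
  · have hc : ContinuousAt (fun r : ℝ => expMix G (r ^ 2 / 2)) r := by
      have h1 : ContinuousAt (fun r : ℝ => r ^ 2 / 2) r := by fun_prop
      exact ContinuousAt.comp (f := fun r : ℝ => r ^ 2 / 2)
        (continuousAt_expMix hm hn hfin (by positivity)) h1
    have : ContinuousAt (tilted G d) r := by
      refine ENNReal.Tendsto.mul (hexp r) (Or.inl (by simpa using Real.exp_pos _)) hc (Or.inr ?_)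
      exact ENNReal.ofReal_ne_top
    exact this.continuousWithinAt.upperSemicontinuousWithinAt

/-- The exponents combine to `-(r - d x)²/(2x)`, which tends to `-∞` for each `x` and is dominated
uniformly in `r ≥ 1`. -/
theorem tendsto_tilted_atTop {G k : ℝ → ℝ} {d : ℝ} (hd : 0 < d)
    (hm : AEMeasurable G (volume.restrict (Ioi (0 : ℝ))))
    (hk : ∀ x ∈ Ioi (0 : ℝ), 0 ≤ k x) (hfin : expMix k (1 / 8) ≠ ∞)
    (hG : ∀ x ∈ Ioi (0 : ℝ), G x = Real.exp (-(d ^ 2 * x / 2)) * k x) :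
    Filter.Tendsto (tilted G d) Filter.atTop (nhds 0) := by
  have heq : tilted G d = fun r => ∫⁻ x in Ioi (0 : ℝ),
      ENNReal.ofReal (Real.exp (d * r)) * ENNReal.ofReal (Real.exp (-(r ^ 2 / 2 / x)) * G x) := by
    ext r
    rw [lintegral_const_mul'' _ (aemeasurable_expMix hm _)]
    rfl
  have hz : (0 : ℝ≥0∞) = ∫⁻ x in Ioi (0 : ℝ), 0 := by simp
  rw [heq, hz]
  refine tendsto_lintegral_filter_of_dominated_convergence'
    (fun x => ENNReal.ofReal (Real.exp (d / 4)) * ENNReal.ofReal (Real.exp (-(1 / 8 / x)) * k x))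
    (Filter.Eventually.of_forall fun r => (aemeasurable_expMix hm _).const_mul _) ?_ ?_ ?_
  · filter_upwards [Filter.eventually_ge_atTop 1] with r hr
    filter_upwards [ae_restrict_mem measurableSet_Ioi] with x hx
    have hx0 : (0 : ℝ) < x := hx
    have hkx := hk x hx
    rw [← ENNReal.ofReal_mul (by positivity), ← ENNReal.ofReal_mul (by positivity), hG x hx]
    refine ENNReal.ofReal_le_ofReal ?_
    rw [← mul_assoc, ← mul_assoc, ← mul_assoc, ← Real.exp_add, ← Real.exp_add, ← Real.exp_add]
    refine mul_le_mul_of_nonneg_right (Real.exp_le_exp.2 ?_) hkx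
    -- Either `d x ≥ 1/2` and the right side is nonnegative, or `r - d x ≥ 1/2` and the square is at
    -- least `1/4`. This is where `1/8` and `d/4` come from.
    have key : (d * r + -(r ^ 2 / 2 / x) + -(d ^ 2 * x / 2)) * (8 * x) ≤
        (d / 4 + -(1 / 8 / x)) * (8 * x) := by
      have e1 : (d * r + -(r ^ 2 / 2 / x) + -(d ^ 2 * x / 2)) * (8 * x) =
          -(4 * (r - d * x) ^ 2) := by
        field_simp
        ring
      have e2 : (d / 4 + -(1 / 8 / x)) * (8 * x) = 2 * (d * x) - 1 := by
        field_simp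
        ring
      rw [e1, e2]
      rcases le_total (1 / 2) (d * x) with h | h
      · nlinarith [sq_nonneg (r - d * x)]
      · have : 0 < d * x := by positivity
        nlinarith
    exact le_of_mul_le_mul_right key (by positivity)
  · rw [lintegral_const_mul' _ _ ENNReal.ofReal_ne_top]
    exact ENNReal.mul_ne_top ENNReal.ofReal_ne_top hfin
  · filter_upwards [ae_restrict_mem measurableSet_Ioi] with x hx
    have hx0 : (0 : ℝ) < x := hx
    have h1 : Filter.Tendsto (fun r : ℝ => r * (d + -(1 / (2 * x)) * r)) Filter.atTop
        Filter.atBot := by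
      refine Filter.tendsto_id.atTop_mul_atBot₀ ?_
      refine Filter.tendsto_atBot_add_const_left _ _ ?_
      exact Filter.tendsto_id.const_mul_atTop_of_neg (by simpa using hx0)
    have h2 := (Real.tendsto_exp_atBot.comp h1).mul_const (G x)
    rw [zero_mul] at h2
    have h3 := ENNReal.tendsto_ofReal h2
    rw [ENNReal.ofReal_zero] at h3
    refine h3.congr fun r => ?_
    rw [← ENNReal.ofReal_mul (by positivity), ← mul_assoc, ← Real.exp_add, Function.comp]
    congr 3
    field_simp

/-! ### Shape of the transform by comparison with kernels -/

theorem tilted_expKernel {c d r : ℝ} (hc : 0 ≤ c) (hd : 0 < d) (hr : 0 ≤ r) :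
    tilted (expKernel c d) d r = ENNReal.ofReal (c * (Real.sqrt (2 * Real.pi) / d)) := by
  rw [tilted, expMix_expKernel hc hd hr, ← ENNReal.ofReal_mul (by positivity)]
  congr 1
  have : Real.exp (d * r) * Real.exp (-(d * r)) = 1 := by rw [← Real.exp_add]; simp
  linear_combination (c * (Real.sqrt (2 * Real.pi) / d)) * this

theorem tilted_le_tilted_iff {G H : ℝ → ℝ} {d r : ℝ} :
    tilted G d r ≤ tilted H d r ↔ expMix G (r ^ 2 / 2) ≤ expMix H (r ^ 2 / 2) :=
  ENNReal.mul_le_mul_iff_right (by simpa using Real.exp_pos _) ENNReal.ofReal_ne_top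

/-- Kernels with `a = d` are the constants of the tilted picture, so every finite level is attained
by one of them. -/
theorem exists_tilted_expKernel_eq {G : ℝ → ℝ} {d r : ℝ} (hd : 0 < d) (h : tilted G d r ≠ ∞) :
    ∃ c, 0 ≤ c ∧ ∀ u, 0 ≤ u → tilted (expKernel c d) d u = tilted G d r := by
  have hc : 0 ≤ (tilted G d r).toReal * (d / Real.sqrt (2 * Real.pi)) := by positivity
  refine ⟨_, hc, fun u hu => ?_⟩
  rw [tilted_expKernel hc hd hu]
  have hpi : 0 < Real.sqrt (2 * Real.pi) := by positivity
  rw [show (tilted G d r).toReal * (d / Real.sqrt (2 * Real.pi)) * (Real.sqrt (2 * Real.pi) / d) =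
    (tilted G d r).toReal by field_simp, ENNReal.ofReal_toReal h]

theorem expMix_expKernel_ne_top {c d r : ℝ} (hc : 0 ≤ c) (hd : 0 < d) (hr : 0 ≤ r) :
    expMix (expKernel c d) (r ^ 2 / 2) ≠ ∞ := by
  rw [expMix_expKernel hc hd hr]
  exact ENNReal.ofReal_ne_top

theorem sq_half_lt {r t : ℝ} (hr : 0 ≤ r) (h : r < t) : r ^ 2 / 2 < t ^ 2 / 2 := by
  nlinarith

/-- Strict quasiconcavity of the tilted transform. -/
theorem tilted_strict_quasiconcave {G : ℝ → ℝ}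
    (hm : AEMeasurable G (volume.restrict (Ioi (0 : ℝ))))
    (hn : ∀ x ∈ Ioi (0 : ℝ), 0 ≤ G x) (hfin : ∀ s, 0 < s → expMix G s ≠ ∞) {d : ℝ} (hd : 0 < d)
    (hne : ∀ c, ¬ G =ᵐ[volume.restrict (Ioi (0 : ℝ))] expKernel c d)
    (hI : ∀ c, 0 ≤ c → {x | 0 < x ∧ expKernel c d x ≤ G x}.OrdConnected)
    {r₁ r₂ r₃ : ℝ} (h₁ : 0 ≤ r₁) (h12 : r₁ < r₂) (h23 : r₂ < r₃)
    (hle₁ : tilted G d r₂ ≤ tilted G d r₁) : tilted G d r₃ < tilted G d r₂ := by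
  by_contra! hle₃
  have h₂ : 0 < r₂ := h₁.trans_lt h12
  have h₃ : 0 < r₃ := h₂.trans h23
  -- If `r₂` were no higher than both neighbours, the kernel at level `tilted G d r₂` would realise
  -- the pattern forbidden by the three-point comparison.
  obtain ⟨c, hc, hcV⟩ := exists_tilted_expKernel_eq hd (tilted_ne_top hfin d h₂)
  have hV₁ := (tilted_le_tilted_iff (G := expKernel c d)).1 ((hcV r₁ h₁).trans_le hle₁)
  have hV₂ := (tilted_le_tilted_iff (H := expKernel c d)).1 (hcV r₂ h₂.le).ge
  have hV₂' := (tilted_le_tilted_iff (G := expKernel c d)).1 (hcV r₂ h₂.le).le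
  have hV₃ := (tilted_le_tilted_iff (G := expKernel c d)).1 ((hcV r₃ h₃.le).trans_le hle₃)
  obtain ⟨α₁, α₂, α₃, -, -, hlt⟩ := expMix_three_point hm (measurable_expKernel c d).aemeasurable hn
    (fun x _ => expKernel_nonneg hc d x) (hI c hc) (fun x _ hxI => hxI.2)
    (fun x hx hxI => le_of_not_ge fun h => hxI ⟨hx, h⟩)
    (sq_half_lt h₁ h12) (sq_half_lt h₂.le h23)
  have hf := fun {r : ℝ} (hr : 0 ≤ r) => expMix_expKernel_ne_top hc hd hr
  have := hlt (hne c) (by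
    refine ENNReal.add_ne_top.2 ⟨ENNReal.add_ne_top.2 ⟨?_, ?_⟩, ?_⟩ <;>
      refine ENNReal.mul_ne_top ENNReal.ofReal_ne_top ?_
    · exact hf h₁
    · exact hf h₃.le
    · exact hfin _ (by positivity))
  refine absurd this (not_lt.2 ?_)
  gcongr

/-- Strict monotonicity of the tilted transform. -/
theorem tilted_strictAntiOn {G : ℝ → ℝ}
    (hm : AEMeasurable G (volume.restrict (Ioi (0 : ℝ))))
    (hn : ∀ x ∈ Ioi (0 : ℝ), 0 ≤ G x) (hfin : ∀ s, 0 < s → expMix G s ≠ ∞) {d : ℝ} (hd : 0 < d)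
    (hne : ∀ c, ¬ G =ᵐ[volume.restrict (Ioi (0 : ℝ))] expKernel c d)
    (hI : ∀ c, 0 ≤ c → ∀ x, expKernel c d x ≤ G x → ∀ y, 0 < y → y ≤ x → expKernel c d y ≤ G y) :
    StrictAntiOn (tilted G d) (Ici 0) := by
  intro r₂ h₂ r₃ h₃ h23
  have h₂ : 0 ≤ r₂ := h₂
  have hr₃ : 0 < r₃ := h₂.trans_lt h23
  have hfin₃ := tilted_ne_top hfin d hr₃
  -- An infinite value can occur only at `r₂ = 0`; no kernel matches it, but then the inequality is
  -- immediate.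
  by_cases hfin₂ : tilted G d r₂ = ∞
  · rw [hfin₂]
    exact lt_top_iff_ne_top.2 hfin₃
  by_contra! hle
  obtain ⟨c, hc, hcV⟩ := exists_tilted_expKernel_eq hd hfin₂
  have hV₂ := (tilted_le_tilted_iff (H := expKernel c d)).1 (hcV r₂ h₂).ge
  have hV₂' := (tilted_le_tilted_iff (G := expKernel c d)).1 (hcV r₂ h₂).le
  have hV₃ := (tilted_le_tilted_iff (G := expKernel c d)).1 ((hcV r₃ hr₃.le).trans_le hle)
  have hf := fun {r : ℝ} (hr : 0 ≤ r) => expMix_expKernel_ne_top hc hd hr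
  obtain ⟨α, hlt⟩ := expMix_two_point hm (measurable_expKernel c d).aemeasurable hn
    (fun x _ => expKernel_nonneg hc d x) (I := {x | expKernel c d x ≤ G x}) (hI c hc)
    (fun x _ hxI => hxI) (fun x hx hxI => le_of_not_ge fun h => hxI h)
    (sq_half_lt h₂ h23) (hne c) (ne_top_of_le_ne_top (hf h₂) hV₂) (hf hr₃.le)
  refine absurd hlt (not_lt.2 ?_)
  gcongr

/-- The exponential interpolating two values of the transform is itself such a transform. -/
theorem exists_expKernel_interpolation {F₁ F₃ r₁ r₃ : ℝ} (h₁ : 0 ≤ r₁) (h13 : r₁ < r₃)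
    (h₃ : 0 < F₃) (hF : F₃ < F₁) :
    ∃ c a, 0 < c ∧ 0 < a ∧ ∀ t ∈ Icc (0 : ℝ) 1,
      expMix (expKernel c a) ((t * r₁ + (1 - t) * r₃) ^ 2 / 2) =
        ENNReal.ofReal (F₁ ^ t * F₃ ^ (1 - t)) := by
  have hF₁ : 0 < F₁ := h₃.trans hF
  have hr : 0 < r₃ - r₁ := sub_pos.2 h13
  -- Minus the slope of the chord of the logarithm; `F₃ < F₁` makes it positive, as a kernel
  -- requires.
  set a := (Real.log F₁ - Real.log F₃) / (r₃ - r₁) with ha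
  have ha0 : 0 < a := div_pos (sub_pos.2 (Real.log_lt_log h₃ hF)) hr
  have hpi : 0 < Real.sqrt (2 * Real.pi) := by positivity
  have hc : 0 < F₁ * Real.exp (a * r₁) * (a / Real.sqrt (2 * Real.pi)) := by positivity
  refine ⟨_, a, hc, ha0, fun t ht => ?_⟩
  have hrt : 0 ≤ t * r₁ + (1 - t) * r₃ :=
    add_nonneg (mul_nonneg ht.1 h₁) (mul_nonneg (sub_nonneg.2 ht.2) (h₁.trans h13.le))
  rw [expMix_expKernel hc.le ha0 hrt]
  congr 1
  rw [show F₁ * Real.exp (a * r₁) * (a / Real.sqrt (2 * Real.pi)) *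
    (Real.sqrt (2 * Real.pi) / a) = F₁ * Real.exp (a * r₁) by field_simp]
  rw [Real.rpow_def_of_pos hF₁, Real.rpow_def_of_pos h₃, ← Real.exp_add]
  nth_rewrite 1 [← Real.exp_log hF₁]
  rw [← Real.exp_add, ← Real.exp_add]
  congr 1
  have har : a * (r₃ - r₁) = Real.log F₁ - Real.log F₃ := by rw [ha]; field_simp
  linear_combination (t - 1) * har

/-- The interpolating kernel agrees with the transform at `r₁` and `r₃`. In the three-point
inequality these terms cancel, leaving the comparison at the middle point. -/
theorem expMix_logConcave_aux {G : ℝ → ℝ}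
    (hm : AEMeasurable G (volume.restrict (Ioi (0 : ℝ))))
    (hn : ∀ x ∈ Ioi (0 : ℝ), 0 ≤ G x) (hne : ¬ G =ᵐ[volume.restrict (Ioi (0 : ℝ))] 0)
    (hfin : ∀ s, 0 ≤ s → expMix G s ≠ ∞)
    (hI : ∀ c a, 0 < c → {x | 0 < x ∧ expKernel c a x ≤ G x}.OrdConnected)
    {r₁ r₃ t : ℝ} (h₁ : 0 ≤ r₁) (h13 : r₁ < r₃) (ht : t ∈ Ioo (0 : ℝ) 1) :
    (expMix G (r₁ ^ 2 / 2)).toReal ^ t * (expMix G (r₃ ^ 2 / 2)).toReal ^ (1 - t) ≤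
      (expMix G ((t * r₁ + (1 - t) * r₃) ^ 2 / 2)).toReal := by
  obtain ⟨ht0, ht1⟩ := ht
  have h12 : r₁ < t * r₁ + (1 - t) * r₃ := by nlinarith
  have h23 : t * r₁ + (1 - t) * r₃ < r₃ := by nlinarith
  have hf : ∀ r : ℝ, expMix G (r ^ 2 / 2) ≠ ∞ := fun r => hfin _ (by positivity)
  have hF₃ := ENNReal.toReal_pos (expMix_pos hm hn hne (r₃ ^ 2 / 2)).ne' (hf r₃)
  have hF₁ := (ENNReal.toReal_lt_toReal (hf r₃) (hf r₁)).2
    (expMix_lt hm hn hne (sq_half_lt h₁ h13) (hf r₃))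
  obtain ⟨c, a, hc, ha, hV⟩ := exists_expKernel_interpolation h₁ h13 hF₃ hF₁
  have hV₁ := hV 1 (by simp)
  have hV₃ := hV 0 (by simp)
  have hV₂ := hV t ⟨ht0.le, ht1.le⟩
  simp only [one_mul, sub_self, zero_mul, add_zero, Real.rpow_one, Real.rpow_zero, mul_one,
    sub_zero, zero_add, ENNReal.ofReal_toReal (hf r₁), ENNReal.ofReal_toReal (hf r₃)] at hV₁ hV₃
  obtain ⟨α₁, α₂, α₃, hα₂, hle, -⟩ := expMix_three_point hm
    (measurable_expKernel c a).aemeasurable hn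
    (fun x _ => expKernel_nonneg hc.le a x) (hI c a hc) (fun x _ hxI => hxI.2)
    (fun x hx hxI => le_of_not_ge fun h => hxI ⟨hx, h⟩)
    (sq_half_lt h₁ h12) (sq_half_lt (h₁.trans h12.le) h23)
  rw [hV₁, hV₃, hV₂] at hle
  have hle := (ENNReal.add_le_add_iff_left (ENNReal.add_ne_top.2
    ⟨ENNReal.mul_ne_top ENNReal.ofReal_ne_top (hf r₁),
      ENNReal.mul_ne_top ENNReal.ofReal_ne_top (hf r₃)⟩)).1 hle
  have hle := (ENNReal.mul_le_mul_iff_right (by simpa using hα₂) ENNReal.ofReal_ne_top).1 hle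
  exact (ENNReal.ofReal_le_iff_le_toReal (hf _)).1 hle

/-- The log-concave argument with `G` and the kernel exchanged. Here `r₁ > 0`, since the transform
may be infinite at `0`. -/
theorem expMix_logConvex_aux {G : ℝ → ℝ}
    (hm : AEMeasurable G (volume.restrict (Ioi (0 : ℝ))))
    (hn : ∀ x ∈ Ioi (0 : ℝ), 0 ≤ G x) (hne : ¬ G =ᵐ[volume.restrict (Ioi (0 : ℝ))] 0)
    (hfin : ∀ s, 0 < s → expMix G s ≠ ∞)
    (hI : ∀ c a, 0 < c → {x | 0 < x ∧ G x ≤ expKernel c a x}.OrdConnected)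
    {r₁ r₃ t : ℝ} (h₁ : 0 < r₁) (h13 : r₁ < r₃) (ht : t ∈ Ioo (0 : ℝ) 1) :
    (expMix G ((t * r₁ + (1 - t) * r₃) ^ 2 / 2)).toReal ≤
      (expMix G (r₁ ^ 2 / 2)).toReal ^ t * (expMix G (r₃ ^ 2 / 2)).toReal ^ (1 - t) := by
  obtain ⟨ht0, ht1⟩ := ht
  have h12 : r₁ < t * r₁ + (1 - t) * r₃ := by nlinarith
  have h23 : t * r₁ + (1 - t) * r₃ < r₃ := by nlinarith
  have hf : ∀ r : ℝ, 0 < r → expMix G (r ^ 2 / 2) ≠ ∞ := fun r hr => hfin _ (by positivity)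
  have hr₃ := h₁.trans h13
  have hF₃ := ENNReal.toReal_pos (expMix_pos hm hn hne (r₃ ^ 2 / 2)).ne' (hf r₃ hr₃)
  have hF₁ := (ENNReal.toReal_lt_toReal (hf r₃ hr₃) (hf r₁ h₁)).2
    (expMix_lt hm hn hne (sq_half_lt h₁.le h13) (hf r₃ hr₃))
  obtain ⟨c, a, hc, ha, hV⟩ := exists_expKernel_interpolation h₁.le h13 hF₃ hF₁
  have hV₁ := hV 1 (by simp)
  have hV₃ := hV 0 (by simp)
  have hV₂ := hV t ⟨ht0.le, ht1.le⟩
  simp only [one_mul, sub_self, zero_mul, add_zero, Real.rpow_one, Real.rpow_zero, mul_one,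
    sub_zero, zero_add, ENNReal.ofReal_toReal (hf r₁ h₁), ENNReal.ofReal_toReal (hf r₃ hr₃)]
    at hV₁ hV₃
  obtain ⟨α₁, α₂, α₃, hα₂, hle, -⟩ := expMix_three_point
    (measurable_expKernel c a).aemeasurable hm
    (fun x _ => expKernel_nonneg hc.le a x) hn (hI c a hc) (fun x _ hxI => hxI.2)
    (fun x hx hxI => le_of_not_ge fun h => hxI ⟨hx, h⟩)
    (sq_half_lt h₁.le h12) (sq_half_lt (h₁.trans h12).le h23)
  rw [hV₁, hV₃, hV₂] at hle
  have hle := (ENNReal.add_le_add_iff_left (ENNReal.add_ne_top.2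
    ⟨ENNReal.mul_ne_top ENNReal.ofReal_ne_top (hf r₁ h₁),
      ENNReal.mul_ne_top ENNReal.ofReal_ne_top (hf r₃ hr₃)⟩)).1 hle
  have hle := (ENNReal.mul_le_mul_iff_right (by simpa using hα₂) ENNReal.ofReal_ne_top).1 hle
  exact ENNReal.toReal_le_of_le_ofReal (by positivity) hle

theorem expMix_logConcave {G : ℝ → ℝ}
    (hm : AEMeasurable G (volume.restrict (Ioi (0 : ℝ))))
    (hn : ∀ x ∈ Ioi (0 : ℝ), 0 ≤ G x) (hne : ¬ G =ᵐ[volume.restrict (Ioi (0 : ℝ))] 0)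
    (hfin : ∀ s, 0 ≤ s → expMix G s ≠ ∞)
    (hI : ∀ c a, 0 < c → {x | 0 < x ∧ expKernel c a x ≤ G x}.OrdConnected)
    {r₁ r₃ t : ℝ} (h₁ : 0 ≤ r₁) (h₃ : 0 ≤ r₃) (ht : t ∈ Ioo (0 : ℝ) 1) :
    (expMix G (r₁ ^ 2 / 2)).toReal ^ t * (expMix G (r₃ ^ 2 / 2)).toReal ^ (1 - t) ≤
      (expMix G ((t * r₁ + (1 - t) * r₃) ^ 2 / 2)).toReal := by
  rcases lt_trichotomy r₁ r₃ with h | rfl | h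
  · exact expMix_logConcave_aux hm hn hne hfin hI h₁ h ht
  · rw [← Real.rpow_add' ENNReal.toReal_nonneg (by norm_num)]
    simp [← add_mul]
  · have := expMix_logConcave_aux hm hn hne hfin hI h₃ h (t := 1 - t)
      ⟨by linarith [ht.2], by linarith [ht.1]⟩
    rwa [sub_sub_cancel, mul_comm, add_comm] at this

theorem expMix_logConvex {G : ℝ → ℝ}
    (hm : AEMeasurable G (volume.restrict (Ioi (0 : ℝ))))
    (hn : ∀ x ∈ Ioi (0 : ℝ), 0 ≤ G x) (hne : ¬ G =ᵐ[volume.restrict (Ioi (0 : ℝ))] 0)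
    (hfin : ∀ s, 0 < s → expMix G s ≠ ∞)
    (hI : ∀ c a, 0 < c → {x | 0 < x ∧ G x ≤ expKernel c a x}.OrdConnected) :
    ConvexOn ℝ (Ioi 0) (fun r : ℝ => Real.log (expMix G (r ^ 2 / 2)).toReal) := by
  refine LinearOrder.convexOn_of_lt (convex_Ioi 0) fun r₁ h₁ r₃ h₃ h13 t u ht hu htu => ?_
  have h₁ : 0 < r₁ := h₁
  obtain rfl : u = 1 - t := by linarith
  have hp : ∀ {r : ℝ}, 0 < r → 0 < (expMix G (r ^ 2 / 2)).toReal := fun {r} hr =>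
    ENNReal.toReal_pos (expMix_pos hm hn hne _).ne' (hfin _ (by positivity))
  have := expMix_logConvex_aux hm hn hne hfin hI h₁ h13 ⟨ht, by linarith⟩
  have hrt : 0 < t * r₁ + (1 - t) * r₃ := by nlinarith
  have hlog := Real.log_le_log (hp hrt) this
  rw [Real.log_mul (Real.rpow_pos_of_pos (hp h₁) _).ne' (Real.rpow_pos_of_pos (hp h₃) _).ne',
    Real.log_rpow (hp h₁), Real.log_rpow (hp h₃)] at hlog
  simpa only [smul_eq_mul] using hlog

/-! ### Local maxima on the half-line -/

/-- A strictly quasiconcave, upper semicontinuous function on `[0, ∞)` that vanishes at infinity has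
exactly one local maximum point. -/
theorem existsUnique_localMax_of_quasiconcave {h : ℝ → ℝ≥0∞}
    (husc : UpperSemicontinuousOn h (Ici 0)) (hlim : Filter.Tendsto h Filter.atTop (nhds 0))
    (hpos : 0 < h 1)
    (hq : ∀ r₁ r₂ r₃, 0 ≤ r₁ → r₁ < r₂ → r₂ < r₃ → h r₂ ≤ h r₁ → h r₃ < h r₂) :
    ∃ r₀, 0 ≤ r₀ ∧ ∀ r, 0 ≤ r → (IsLocalMaxOn h (Ici 0) r ↔ r = r₀) := by
  obtain ⟨R, hR⟩ := Filter.eventually_atTop.1 (hlim.eventually_lt_const hpos)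
  obtain ⟨r₀, hr₀, hmax⟩ := (husc.mono (fun x hx => hx.1 : Icc 0 (max R 1) ⊆ Ici 0)).exists_isMaxOn
    ⟨0, by simp⟩ isCompact_Icc
  have hglob : ∀ r, 0 ≤ r → h r ≤ h r₀ := by
    intro r hr
    rcases le_total r (max R 1) with hle | hle
    · exact hmax ⟨hr, hle⟩
    · exact (hR r ((le_max_left _ _).trans hle)).le.trans (hmax ⟨zero_le_one, le_max_right _ _⟩)
  have hloc₀ : IsLocalMaxOn h (Ici 0) r₀ := by
    filter_upwards [self_mem_nhdsWithin] with r hr using hglob r hr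
  -- Points just right of `a` and just left of `b` are no higher than `a` and `b`. Strict
  -- quasiconcavity makes the function fall from the first point on, so it is still falling at `b`,
  -- against local maximality there.
  have huniq : ∀ a b, 0 ≤ a → a < b → IsLocalMaxOn h (Ici 0) a → IsLocalMaxOn h (Ici 0) b →
      False := by
    intro a b ha hab hla hlb
    have h1 : ∀ᶠ r in nhdsWithin a (Ioi a), h r ≤ h a :=
      hla.filter_mono (nhdsWithin_mono _ fun r hr => ha.trans (le_of_lt hr))
    obtain ⟨x, hxa, hx⟩ := (h1.and (Ioo_mem_nhdsGT hab)).exists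
    have hbx := hq a x b ha hx.1 hx.2 hxa
    have h2 : ∀ᶠ r in nhdsWithin b (Iio b), h r ≤ h b := by
      have : nhdsWithin b (Iio b) ≤ nhdsWithin b (Ici 0) := by
        refine le_inf inf_le_left (Filter.le_principal_iff.2 ?_)
        filter_upwards [Ioo_mem_nhdsLT (ha.trans_lt hab)] with r hr using hr.1.le
      exact hlb.filter_mono this
    obtain ⟨y, hyb, hy⟩ := (h2.and (Ioo_mem_nhdsLT hx.2)).exists
    have := hq x y b (ha.trans hx.1.le) hy.1 hy.2 (hyb.trans hbx.le)
    exact absurd this (not_lt.2 hyb)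
  refine ⟨r₀, hr₀.1, fun r hr => ⟨fun hl => ?_, fun he => he ▸ hloc₀⟩⟩
  rcases lt_trichotomy r r₀ with hlt | heq | hlt
  · exact (huniq _ _ hr hlt hl hloc₀).elim
  · exact heq
  · exact (huniq _ _ hr₀.1 hlt hloc₀ hl).elim

theorem isLocalMaxOn_iff_of_strictAntiOn {h : ℝ → ℝ≥0∞} (hh : StrictAntiOn h (Ici 0)) {r : ℝ}
    (hr : 0 ≤ r) : IsLocalMaxOn h (Ici 0) r ↔ r = 0 := by
  constructor
  · intro hl
    by_contra hne
    have hr0 : 0 < r := lt_of_le_of_ne hr (Ne.symm hne)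
    have h2 : ∀ᶠ x in nhdsWithin r (Iio r), h x ≤ h r := by
      have : nhdsWithin r (Iio r) ≤ nhdsWithin r (Ici 0) := by
        refine le_inf inf_le_left (Filter.le_principal_iff.2 ?_)
        filter_upwards [Ioo_mem_nhdsLT hr0] with x hx using hx.1.le
      exact hl.filter_mono this
    obtain ⟨x, hx, hx'⟩ := (h2.and (Ioo_mem_nhdsLT hr0)).exists
    exact absurd hx (not_le.2 (hh (mem_Ici.2 hx'.1.le) hr hx'.2))
  · rintro rfl
    filter_upwards [self_mem_nhdsWithin] with x hx
    rcases (mem_Ici.1 hx).eq_or_lt with rfl | hx0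
    · exact le_rfl
    · exact (hh (mem_Ici.2 le_rfl) hx hx0).le

/-! ### From the half-line to the whole space -/

section Radial

variable {E : Type*} [NormedAddCommGroup E] [InnerProductSpace ℝ E]

/-- An exponentially tilted radial function. -/
noncomputable def tiltedRadial (G : ℝ → ℝ) (γ w : E) : ℝ≥0∞ :=
  ENNReal.ofReal (Real.exp (inner ℝ w γ)) * expMix G (‖w‖ ^ 2 / 2)

theorem tiltedRadial_le {G : ℝ → ℝ} (γ w : E) : tiltedRadial G γ w ≤ tilted G ‖γ‖ ‖w‖ := by
  unfold tiltedRadial tilted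
  gcongr
  exact (real_inner_le_norm w γ).trans_eq (mul_comm _ _)

theorem tiltedRadial_ray {G : ℝ → ℝ} {γ : E} (hγ : γ ≠ 0) {r : ℝ} (hr : 0 ≤ r) :
    tiltedRadial G γ ((r / ‖γ‖) • γ) = tilted G ‖γ‖ r := by
  have hd : 0 < ‖γ‖ := norm_pos_iff.2 hγ
  have h1 : ‖(r / ‖γ‖) • γ‖ = r := by
    rw [norm_smul, Real.norm_of_nonneg (by positivity)]
    field_simp
  have h2 : inner ℝ ((r / ‖γ‖) • γ) γ = ‖γ‖ * r := by
    rw [real_inner_smul_left, real_inner_self_eq_norm_sq]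
    field_simp
  rw [tiltedRadial, tilted, h1, h2]

/-- Off the ray of `γ`, moving towards the point of that ray with the same norm does not increase
the norm and strictly increases the inner product, hence the value. On the ray the function equals
its radial majorant `tilted G ‖γ‖ ‖w‖`. -/
theorem isLocalMax_tiltedRadial_iff {G : ℝ → ℝ}
    (hn : ∀ x ∈ Ioi (0 : ℝ), 0 ≤ G x) (hpos : ∀ s, 0 < expMix G s)
    (hfin : ∀ s, 0 < s → expMix G s ≠ ∞) {γ : E} (hγ : γ ≠ 0) {r₀ : ℝ} (hr₀ : 0 ≤ r₀)
    (h : ∀ r, 0 ≤ r → (IsLocalMaxOn (tilted G ‖γ‖) (Ici 0) r ↔ r = r₀)) (w : E) :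
    IsLocalMax (tiltedRadial G γ) w ↔ w = (r₀ / ‖γ‖) • γ := by
  have hd : 0 < ‖γ‖ := norm_pos_iff.2 hγ
  constructor
  · intro hw
    have hin : inner ℝ w γ = ‖w‖ * ‖γ‖ := by
      by_contra hne
      have hlt : inner ℝ w γ < ‖w‖ * ‖γ‖ := lt_of_le_of_ne (real_inner_le_norm w γ) hne
      have hw0 : 0 < ‖w‖ := by
        refine norm_pos_iff.2 fun h0 => ?_
        simp [h0] at hlt
      set v : E := (‖w‖ / ‖γ‖) • γ with hv
      have hvn : ‖v‖ = ‖w‖ := by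
        rw [hv, norm_smul, Real.norm_of_nonneg (by positivity)]
        field_simp
      have hvi : inner ℝ v γ = ‖w‖ * ‖γ‖ := by
        rw [hv, real_inner_smul_left, real_inner_self_eq_norm_sq]
        field_simp
      have hcont : Filter.Tendsto (fun t : ℝ => (1 - t) • w + t • v) (nhdsWithin 0 (Ioi 0))
          (nhds w) := by
        have : Continuous fun t : ℝ => (1 - t) • w + t • v := by fun_prop
        have h0 := this.tendsto 0
        simp only [sub_zero, one_smul, zero_smul, add_zero] at h0
        exact h0.mono_left inf_le_left
      obtain ⟨t, ht, ht0, ht1⟩ := ((hcont.eventually hw).and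
        (Ioo_mem_nhdsGT (zero_lt_one (α := ℝ)))).exists
      have hnorm : ‖(1 - t) • w + t • v‖ ≤ ‖w‖ := by
        refine (norm_add_le _ _).trans ?_
        rw [norm_smul, norm_smul, Real.norm_of_nonneg (by linarith), Real.norm_of_nonneg ht0.le,
          hvn]
        linarith
      have hinn : inner ℝ w γ < inner ℝ ((1 - t) • w + t • v) γ := by
        rw [inner_add_left, real_inner_smul_left, real_inner_smul_left, hvi]
        nlinarith
      refine absurd ht (not_le.2 ?_)
      refine lt_of_lt_of_le ?_ (mul_le_mul_right (expMix_anti hn (t := ‖w‖ ^ 2 / 2) (by gcongr)) _)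
      refine ENNReal.mul_lt_mul_left (hpos _).ne' (hfin _ (by positivity)) ?_
      exact (ENNReal.ofReal_lt_ofReal_iff (Real.exp_pos _)).2 (Real.exp_lt_exp.2 hinn)
    have hwγ : w = (‖w‖ / ‖γ‖) • γ := by
      have := inner_eq_norm_mul_iff_real.1 hin
      rw [div_eq_inv_mul, mul_smul, ← this, smul_smul, inv_mul_cancel₀ hd.ne', one_smul]
    have hloc : IsLocalMaxOn (tilted G ‖γ‖) (Ici 0) ‖w‖ := by
      have hcont : Filter.Tendsto (fun r : ℝ => (r / ‖γ‖) • γ) (nhds ‖w‖) (nhds w) := by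
        have : Continuous fun r : ℝ => (r / ‖γ‖) • γ := by fun_prop
        have h0 := this.tendsto ‖w‖
        rwa [← hwγ] at h0
      filter_upwards [(hcont.eventually hw).filter_mono inf_le_left, self_mem_nhdsWithin] with r hr
        hr0
      rw [tiltedRadial_ray hγ hr0] at hr
      exact hr.trans (tiltedRadial_le γ w)
    rw [← (h _ (norm_nonneg w)).1 hloc]
    exact hwγ
  · rintro rfl
    have hloc := (h r₀ hr₀).2 rfl
    have hnr : ‖(r₀ / ‖γ‖) • γ‖ = r₀ := by
      rw [norm_smul, Real.norm_of_nonneg (by positivity)]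
      field_simp
    have hcont : Filter.Tendsto (fun w : E => ‖w‖) (nhds ((r₀ / ‖γ‖) • γ))
        (nhdsWithin r₀ (Ici 0)) := by
      refine tendsto_nhdsWithin_iff.2 ⟨?_, Filter.Eventually.of_forall fun w => norm_nonneg w⟩
      have := (continuous_norm (E := E)).tendsto ((r₀ / ‖γ‖) • γ)
      rwa [hnr] at this
    filter_upwards [hcont.eventually hloc] with w hw
    rw [tiltedRadial_ray hγ hr₀]
    exact (tiltedRadial_le γ w).trans hw

theorem isLocalMax_tiltedRadial_zero_iff {G : ℝ → ℝ}
    (hm : AEMeasurable G (volume.restrict (Ioi (0 : ℝ))))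
    (hn : ∀ x ∈ Ioi (0 : ℝ), 0 ≤ G x) (hne : ¬ G =ᵐ[volume.restrict (Ioi (0 : ℝ))] 0)
    (hfin : ∀ s, 0 < s → expMix G s ≠ ∞) (w : E) :
    IsLocalMax (tiltedRadial G (0 : E)) w ↔ w = 0 := by
  have hF : tiltedRadial G (0 : E) = fun w => expMix G (‖w‖ ^ 2 / 2) := by
    ext w
    simp [tiltedRadial]
  rw [hF]
  constructor
  · intro hw
    by_contra h0
    have hw0 : 0 < ‖w‖ := norm_pos_iff.2 h0
    have hcont : Filter.Tendsto (fun t : ℝ => (1 - t) • w) (nhdsWithin 0 (Ioi 0)) (nhds w) := by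
      have : Continuous fun t : ℝ => (1 - t) • w := by fun_prop
      have h0 := this.tendsto 0
      simp only [sub_zero, one_smul] at h0
      exact h0.mono_left inf_le_left
    obtain ⟨t, ht, ht0, ht1⟩ := ((hcont.eventually hw).and
        (Ioo_mem_nhdsGT (zero_lt_one (α := ℝ)))).exists
    refine absurd ht (not_le.2 (expMix_lt hm hn hne ?_ (hfin _ (by positivity))))
    rw [norm_smul, Real.norm_of_nonneg (by linarith)]
    exact sq_half_lt (mul_nonneg (by linarith) hw0.le) (by nlinarith)
  · rintro rfl
    refine Filter.Eventually.of_forall fun w => expMix_anti hn ?_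
    rw [norm_zero]
    gcongr
    positivity

end Radial

/-! ### The mixture density in terms of the transform -/

theorem isUnit_det_of_rank_eq {p : ℕ} {A : Matrix (Fin p) (Fin p) ℝ} (hA : A.rank = p) :
    IsUnit A.det := by
  rw [← Matrix.isUnit_iff_isUnit_det, ← Matrix.linearIndependent_cols_iff_isUnit,
    linearIndependent_iff_card_eq_finrank_span, Fintype.card_fin, Set.finrank,
    ← Matrix.rank_eq_finrank_span_cols, hA]

/-- The mixing density with the dimension-dependent part of the Gaussian normalization. -/
noncomputable def weighted (p : ℕ) (g : ℝ → ℝ) (x : ℝ) : ℝ := (Real.sqrt x)⁻¹ * gStar p g x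

/-- The mixing density with all factors of the Gaussian density that do not depend on the
position. -/
noncomputable def weightedTilt (p : ℕ) (g : ℝ → ℝ) (d x : ℝ) : ℝ :=
  Real.exp (-(d ^ 2 * x / 2)) * weighted p g x

theorem weighted_eq (p : ℕ) (g : ℝ → ℝ) {x : ℝ} (hx : 0 < x) :
    weighted p g x = x ^ (-(p : ℝ) / 2) * g x := by
  rw [weighted, gStar, Real.sqrt_eq_rpow, ← Real.rpow_neg hx.le, ← mul_assoc, ← Real.rpow_add hx]
  congr 2
  ring

theorem gStar_nonneg {p : ℕ} {g : ℝ → ℝ} (hg : ∀ x ∈ Ioi (0 : ℝ), 0 ≤ g x) {x : ℝ} (hx : 0 < x) :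
    0 ≤ gStar p g x :=
  mul_nonneg (Real.rpow_nonneg hx.le _) (hg x hx)

theorem weighted_nonneg {p : ℕ} {g : ℝ → ℝ} (hg : ∀ x ∈ Ioi (0 : ℝ), 0 ≤ g x) :
    ∀ x ∈ Ioi (0 : ℝ), 0 ≤ weighted p g x := fun x hx =>
  mul_nonneg (by positivity) (gStar_nonneg hg hx)

theorem weightedTilt_nonneg {p : ℕ} {g : ℝ → ℝ} (hg : ∀ x ∈ Ioi (0 : ℝ), 0 ≤ g x) (d : ℝ) :
    ∀ x ∈ Ioi (0 : ℝ), 0 ≤ weightedTilt p g d x := fun x hx =>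
  mul_nonneg (by positivity) (weighted_nonneg hg x hx)

theorem weightedTilt_le {p : ℕ} {g : ℝ → ℝ} (hg : ∀ x ∈ Ioi (0 : ℝ), 0 ≤ g x) (d : ℝ) :
    ∀ x ∈ Ioi (0 : ℝ), weightedTilt p g d x ≤ weighted p g x := fun x hx => by
  have hx0 : (0 : ℝ) < x := hx
  refine mul_le_of_le_one_left (weighted_nonneg hg x hx) (Real.exp_le_one_iff.2 ?_)
  rw [neg_nonpos]
  positivity

theorem aemeasurable_weighted {p : ℕ} {g : ℝ → ℝ}
    (hg : AEMeasurable g (volume.restrict (Ioi (0 : ℝ)))) :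
    AEMeasurable (weighted p g) (volume.restrict (Ioi (0 : ℝ))) := by
  have h1 : Measurable fun x : ℝ => (Real.sqrt x)⁻¹ := by fun_prop
  have h2 : Measurable fun x : ℝ => x ^ (-((p : ℝ) - 1) / 2) := by fun_prop
  exact h1.aemeasurable.mul (h2.aemeasurable.mul hg)

theorem aemeasurable_weightedTilt {p : ℕ} {g : ℝ → ℝ}
    (hg : AEMeasurable g (volume.restrict (Ioi (0 : ℝ)))) (d : ℝ) :
    AEMeasurable (weightedTilt p g d) (volume.restrict (Ioi (0 : ℝ))) := by
  have h1 : Measurable fun x : ℝ => Real.exp (-(d ^ 2 * x / 2)) := by fun_prop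
  exact h1.aemeasurable.mul (aemeasurable_weighted hg)

/-- From `z ≤ exp z` at `z = s/(x a)`, raised to the power `a`. -/
theorem exists_rpow_neg_mul_exp_le {a s : ℝ} (ha : 0 < a) (hs : 0 < s) :
    ∃ B, 0 ≤ B ∧ ∀ x, 0 < x → Real.exp (-(s / x)) * x ^ (-a) ≤ B := by
  refine ⟨(a / s) ^ a, by positivity, fun x hx => ?_⟩
  have h1 : s / x / a ≤ Real.exp (s / x / a) := by
    linarith [Real.add_one_le_exp (s / x / a)]
  have h2 := Real.rpow_le_rpow (by positivity) h1 ha.le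
  rw [← Real.exp_mul, div_mul_cancel₀ _ ha.ne'] at h2
  have h3 : x ^ (-a) = (a / s) ^ a * (s / x / a) ^ a := by
    rw [← Real.mul_rpow (by positivity) (by positivity), Real.rpow_neg hx.le,
      ← Real.inv_rpow hx.le]
    congr 1
    field_simp
  rw [h3, mul_left_comm]
  refine mul_le_of_le_one_right (by positivity) ?_
  rw [Real.exp_neg, inv_mul_le_iff₀ (Real.exp_pos _), mul_one]
  exact h2

theorem expMix_weighted_ne_top {p : ℕ} (hp : 1 ≤ p) {g : ℝ → ℝ}
    (hg : ∀ x ∈ Ioi (0 : ℝ), 0 ≤ g x)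
    (hint : ∫⁻ x in Ioi (0 : ℝ), ENNReal.ofReal (g x) = 1) {s : ℝ} (hs : 0 < s) :
    expMix (weighted p g) s ≠ ∞ := by
  have hp0 : (0 : ℝ) < p := by exact_mod_cast hp
  obtain ⟨B, hB, hle⟩ := exists_rpow_neg_mul_exp_le (a := (p : ℝ) / 2) (by positivity) hs
  have : expMix (weighted p g) s ≤ ENNReal.ofReal B := by
    rw [← mul_one (ENNReal.ofReal B), ← hint, ← lintegral_const_mul' _ _ ENNReal.ofReal_ne_top]
    refine setLIntegral_mono' measurableSet_Ioi fun x hx => ?_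
    rw [← ENNReal.ofReal_mul hB]
    refine ENNReal.ofReal_le_ofReal ?_
    rw [weighted_eq p g hx, ← mul_assoc, neg_div]
    exact mul_le_mul_of_nonneg_right (hle x hx) (hg x hx)
  exact ne_top_of_le_ne_top ENNReal.ofReal_ne_top this

theorem expMix_weightedTilt_ne_top {p : ℕ} (hp : 1 ≤ p) {g : ℝ → ℝ}
    (hg : ∀ x ∈ Ioi (0 : ℝ), 0 ≤ g x)
    (hint : ∫⁻ x in Ioi (0 : ℝ), ENNReal.ofReal (g x) = 1) (d : ℝ) {s : ℝ} (hs : 0 < s) :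
    expMix (weightedTilt p g d) s ≠ ∞ := by
  refine ne_top_of_le_ne_top (expMix_weighted_ne_top hp hg hint hs)
    (setLIntegral_mono' measurableSet_Ioi fun x hx => ENNReal.ofReal_le_ofReal ?_)
  exact mul_le_mul_of_nonneg_left (weightedTilt_le hg d x hx) (Real.exp_pos _).le

/-- Equality would force `g` to be a multiple of `x^((p-1)/2)`, which has integral `0` or `∞` in
place of `1`. This is the source of all strict inequalities for the profile. -/
theorem weightedTilt_not_ae_eq_expKernel {p : ℕ} (hp : 1 ≤ p) {g : ℝ → ℝ}
    (hint : ∫⁻ x in Ioi (0 : ℝ), ENNReal.ofReal (g x) = 1) (d c : ℝ) :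
    ¬ weightedTilt p g d =ᵐ[volume.restrict (Ioi (0 : ℝ))] expKernel c d := by
  intro h
  have hgc : ∀ᵐ x ∂(volume.restrict (Ioi (0 : ℝ))), g x = c * x ^ (((p : ℝ) - 1) / 2) := by
    filter_upwards [h, ae_restrict_mem measurableSet_Ioi] with x hx hx0
    have hx0 : (0 : ℝ) < x := hx0
    have hs := Real.sqrt_pos.2 hx0
    have hr := Real.rpow_pos_of_pos hx0 (((p : ℝ) - 1) / 2)
    rw [weightedTilt, weighted, expKernel, gStar, neg_div, Real.rpow_neg hx0.le] at hx
    have he := Real.exp_pos (-(d ^ 2 * x / 2))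
    field_simp at hx
    rw [hx, mul_comm]
  rw [lintegral_congr_ae (g := fun x => ENNReal.ofReal (c * x ^ (((p : ℝ) - 1) / 2)))
    (hgc.mono fun x hx => by simp only [hx])] at hint
  rcases le_or_gt c 0 with hc | hc
  · have h0 : ∫⁻ x in Ioi (0 : ℝ), ENNReal.ofReal (c * x ^ (((p : ℝ) - 1) / 2)) =
        ∫⁻ x in Ioi (0 : ℝ), 0 := by
      refine setLIntegral_congr_fun measurableSet_Ioi fun x hx => ?_
      have hx0 : (0 : ℝ) < x := hx
      exact ENNReal.ofReal_of_nonpos (mul_nonpos_of_nonpos_of_nonneg hc (by positivity))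
    rw [h0] at hint
    simp at hint
  · have h1 : ∫⁻ x in Ioi (1 : ℝ), ENNReal.ofReal c ≤ 1 := by
      rw [← hint]
      refine (setLIntegral_mono' measurableSet_Ioi fun x hx => ?_).trans
        (lintegral_mono_set (Ioi_subset_Ioi zero_le_one))
      have hx1 : (1 : ℝ) < x := hx
      refine ENNReal.ofReal_le_ofReal (le_mul_of_one_le_right hc.le ?_)
      refine Real.one_le_rpow hx1.le (div_nonneg ?_ zero_le_two)
      rw [sub_nonneg]
      exact_mod_cast hp
    rw [setLIntegral_const, Real.volume_Ioi, ENNReal.mul_top (by simpa using hc)] at h1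
    exact absurd h1 (by simp)

theorem weightedTilt_not_ae_eq_zero {p : ℕ} (hp : 1 ≤ p) {g : ℝ → ℝ}
    (hint : ∫⁻ x in Ioi (0 : ℝ), ENNReal.ofReal (g x) = 1) (d : ℝ) :
    ¬ weightedTilt p g d =ᵐ[volume.restrict (Ioi (0 : ℝ))] 0 := by
  have := weightedTilt_not_ae_eq_expKernel hp hint d 0
  rwa [show expKernel 0 d = 0 by ext; simp [expKernel]] at this

/-- The mixture density in the coordinates `A⁻¹ (y - μ)`. -/
theorem mixtureDensity_eq {p : ℕ} (μ β : EuclideanSpace ℝ (Fin p))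
    (A : Matrix (Fin p) (Fin p) ℝ) {g : ℝ → ℝ}
    (hg_meas : AEMeasurable g (volume.restrict (Ioi (0 : ℝ))))
    (y : EuclideanSpace ℝ (Fin p)) :
    mixtureDensity μ β A g y = ENNReal.ofReal ((2 * Real.pi) ^ (-(p : ℝ) / 2) * |A.det|⁻¹) *
      tiltedRadial (weightedTilt p g ‖Matrix.toEuclideanLin A⁻¹ β‖)
        (Matrix.toEuclideanLin A⁻¹ β) (Matrix.toEuclideanLin A⁻¹ (y - μ)) := by
  set γ := Matrix.toEuclideanLin A⁻¹ β
  set w := Matrix.toEuclideanLin A⁻¹ (y - μ) with hw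
  rw [tiltedRadial, ← mul_assoc, expMix, ← lintegral_const_mul'' _
    (aemeasurable_expMix (aemeasurable_weightedTilt hg_meas _) _), mixtureDensity]
  refine setLIntegral_congr_fun measurableSet_Ioi fun x hx => ?_
  have hx0 : (0 : ℝ) < x := hx
  have e1 : Matrix.toEuclideanLin A⁻¹ (y - μ - x • β) = w - x • γ := by
    rw [map_sub, map_smul]
  rw [e1, ← ENNReal.ofReal_mul (by positivity), ← ENNReal.ofReal_mul (by positivity), weightedTilt,
    weighted_eq p g hx0, Real.mul_rpow (by positivity) hx0.le]
  congr 1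
  have e2 : Real.exp (-‖w - x • γ‖ ^ 2 / (2 * x)) = Real.exp (inner ℝ w γ) *
      Real.exp (-(‖w‖ ^ 2 / 2 / x)) * Real.exp (-(‖γ‖ ^ 2 * x / 2)) := by
    rw [← Real.exp_add, ← Real.exp_add, norm_sub_sq_real, real_inner_smul_right, norm_smul,
      Real.norm_of_nonneg hx0.le]
    congr 1
    field_simp
    ring
  rw [e2]
  ring

theorem weightedTilt_eq_mul (p : ℕ) (g : ℝ → ℝ) (d x : ℝ) :
    weightedTilt p g d x = (Real.sqrt x)⁻¹ * Real.exp (-(d ^ 2 * x / 2)) * gStar p g x := by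
  rw [weightedTilt, weighted]
  ring

/-- Pulls out the factor shared with `weightedTilt`, so that comparing the two compares `gStar` with
an exponential, or with a constant when `a = d`. -/
theorem expKernel_eq_mul (c a d x : ℝ) :
    expKernel c a x = (Real.sqrt x)⁻¹ * Real.exp (-(d ^ 2 * x / 2)) *
      (c * Real.exp ((d ^ 2 - a ^ 2) / 2 * x)) := by
  have he : Real.exp (-(a ^ 2 * x / 2)) =
      Real.exp (-(d ^ 2 * x / 2)) * Real.exp ((d ^ 2 - a ^ 2) / 2 * x) := by
    rw [← Real.exp_add]
    congr 1
    ring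
  rw [expKernel, he]
  ring

theorem expKernel_le_weightedTilt_iff {p : ℕ} {g : ℝ → ℝ} {c a d x : ℝ} (hx : 0 < x) :
    expKernel c a x ≤ weightedTilt p g d x ↔
      c * Real.exp ((d ^ 2 - a ^ 2) / 2 * x) ≤ gStar p g x := by
  have := Real.sqrt_pos.2 hx
  rw [expKernel_eq_mul c a d, weightedTilt_eq_mul, mul_le_mul_iff_right₀ (by positivity)]

theorem weightedTilt_le_expKernel_iff {p : ℕ} {g : ℝ → ℝ} {c a d x : ℝ} (hx : 0 < x) :
    weightedTilt p g d x ≤ expKernel c a x ↔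
      gStar p g x ≤ c * Real.exp ((d ^ 2 - a ^ 2) / 2 * x) := by
  have := Real.sqrt_pos.2 hx
  rw [expKernel_eq_mul c a d, weightedTilt_eq_mul, mul_le_mul_iff_right₀ (by positivity)]

/-! ### Shape conditions as interval conditions; finiteness at the centre -/

theorem UnimodalOn.ordConnected {q : ℝ → ℝ} (hq : UnimodalOn (Ioi 0) q) (c : ℝ) :
    {x | 0 < x ∧ c ≤ q x}.OrdConnected := by
  obtain ⟨m, hmono, hanti⟩ := hq
  refine ⟨fun x hx y hy z hz => ?_⟩
  have hz0 : 0 < z := hx.1.trans_le hz.1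
  refine ⟨hz0, ?_⟩
  rcases le_total z m with h | h
  · exact hx.2.trans (hmono ⟨hx.1, hz.1.trans h⟩ ⟨hz0, h⟩ hz.1)
  · exact hy.2.trans (hanti ⟨hz0, h⟩ ⟨hy.1, h.trans hz.2⟩ hz.2)

theorem LogConcaveOn.ordConnected {q : ℝ → ℝ} (hq : LogConcaveOn (Ioi 0) q) {c : ℝ} (hc : 0 < c)
    (k : ℝ) : {x | 0 < x ∧ c * Real.exp (k * x) ≤ q x}.OrdConnected := by
  refine Convex.ordConnected (convex_iff_forall_pos.2 fun x hx y hy a b ha hb hab => ?_)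
  obtain rfl : b = 1 - a := by linarith
  have hz : 0 < a * x + (1 - a) * y := by nlinarith [hx.1, hy.1]
  refine ⟨hz, le_trans ?_ (hq.2.2 x hx.1 y hy.1 a ⟨ha, by linarith⟩)⟩
  have h1 := Real.rpow_le_rpow (by positivity) hx.2 ha.le
  have h2 := Real.rpow_le_rpow (by positivity) hy.2 hb.le
  refine le_trans (le_of_eq ?_) (mul_le_mul h1 h2 (by positivity)
    (Real.rpow_nonneg (hq.2.1 x hx.1) _))
  rw [Real.mul_rpow hc.le (by positivity), Real.mul_rpow hc.le (by positivity), ← Real.exp_mul,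
    ← Real.exp_mul, mul_mul_mul_comm, ← Real.rpow_add hc, ← Real.exp_add, add_sub_cancel,
    Real.rpow_one]
  simp only [smul_eq_mul]
  ring_nf

theorem LogConvexOn.ordConnected {q : ℝ → ℝ} (hq : LogConvexOn (Ioi 0) q) {c : ℝ} (hc : 0 < c)
    (k : ℝ) : {x | 0 < x ∧ q x ≤ c * Real.exp (k * x)}.OrdConnected := by
  refine Convex.ordConnected (convex_iff_forall_pos.2 fun x hx y hy a b ha hb hab => ?_)
  have hz : 0 < a * x + b * y := by nlinarith [hx.1, hy.1]
  have hlog : ∀ {x}, 0 < x → (q x ≤ c * Real.exp (k * x) ↔ Real.log (q x) ≤ Real.log c + k * x) := by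
    intro x hx
    rw [← Real.log_le_log_iff (hq.1 x hx) (by positivity),
      Real.log_mul hc.ne' (Real.exp_pos _).ne', Real.log_exp]
  refine ⟨hz, ?_⟩
  have h1 := (hlog hx.1).1 hx.2
  have h2 := (hlog hy.1).1 hy.2
  have h3 := hq.2.2 hx.1 hy.1 ha.le hb.le hab
  simp only [smul_eq_mul] at h3 ⊢
  rw [hlog hz]
  refine h3.trans ?_
  calc a * Real.log (q x) + b * Real.log (q y)
      ≤ a * (Real.log c + k * x) + b * (Real.log c + k * y) :=
        add_le_add (mul_le_mul_of_nonneg_left h1 ha.le) (mul_le_mul_of_nonneg_left h2 hb.le)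
    _ = (a + b) * Real.log c + k * (a * x + b * y) := by ring
    _ = Real.log c + k * (a * x + b * y) := by rw [hab, one_mul]

/-- With `x₀` between `x` and `x₁`, concavity of the logarithm bounds `log q(x)` by extrapolation
from `x₁` through `x₀`. The weight `t` of `x` stays above `(x₁ - x₀)/x₁`, so the bound is uniform.
-/
theorem LogConcaveOn.bounded_near_zero {q : ℝ → ℝ} (hq : LogConcaveOn (Ioi 0) q) {x₀ x₁ : ℝ}
    (h₀ : 0 < x₀) (h01 : x₀ < x₁) (hq₁ : 0 < q x₁) :
    ∃ M, 0 ≤ M ∧ ∀ x, 0 < x → x < x₀ → q x ≤ M := by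
  set L := (|Real.log (q x₀)| + |Real.log (q x₁)|) / ((x₁ - x₀) / x₁) with hL
  have h₁ := h₀.trans h01
  have hm : 0 < (x₁ - x₀) / x₁ := div_pos (by linarith) h₁
  refine ⟨Real.exp L, (Real.exp_pos _).le, fun x hx hxx => ?_⟩
  rcases (hq.2.1 x hx).eq_or_lt with h | hqx
  · rw [← h]
    exact (Real.exp_pos _).le
  have hd : 0 < x₁ - x := by linarith
  set t := (x₁ - x₀) / (x₁ - x) with ht
  have ht0 : 0 < t := div_pos (by linarith) hd
  have ht1 : t < 1 := by rw [ht, div_lt_one hd]; linarith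
  have htm : (x₁ - x₀) / x₁ ≤ t := div_le_div_of_nonneg_left (by linarith) hd (by linarith)
  have hxt : t • x + (1 - t) • x₁ = x₀ := by
    rw [smul_eq_mul, smul_eq_mul, ht]
    field_simp
    ring
  have h := hq.2.2 x hx x₁ h₁ t ⟨ht0, ht1⟩
  rw [hxt] at h
  have hlog := Real.log_le_log (by positivity) h
  rw [Real.log_mul (by positivity) (by positivity), Real.log_rpow hqx, Real.log_rpow hq₁] at hlog
  rw [← Real.log_le_iff_le_exp hqx]
  have h2 : t * Real.log (q x) ≤ |Real.log (q x₀)| + |Real.log (q x₁)| := by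
    have e1 := le_abs_self (Real.log (q x₀))
    have e2 := neg_abs_le (Real.log (q x₁))
    have e3 := abs_nonneg (Real.log (q x₁))
    nlinarith
  have hLm : L * ((x₁ - x₀) / x₁) = |Real.log (q x₀)| + |Real.log (q x₁)| :=
    div_mul_cancel₀ _ hm.ne'
  have hL0 : 0 ≤ L := by positivity
  refine le_of_mul_le_mul_left ?_ ht0
  nlinarith

theorem expMix_weightedTilt_zero_ne_top {p : ℕ} (hp : 1 ≤ p) {g : ℝ → ℝ}
    (hg : ∀ x ∈ Ioi (0 : ℝ), 0 ≤ g x)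
    (hint : ∫⁻ x in Ioi (0 : ℝ), ENNReal.ofReal (g x) = 1)
    (hq : LogConcaveOn (Ioi 0) (gStar p g)) (d : ℝ) :
    expMix (weightedTilt p g d) 0 ≠ ∞ := by
  obtain ⟨x₀, x₁, h₀, h01, hq₁⟩ :
      ∃ x₀ x₁, 0 < x₀ ∧ x₀ < x₁ ∧ 0 < gStar p g x₁ := by
    -- Two points of positivity exist, since otherwise the density would vanish almost everywhere.
    have hns : ¬ {x | 0 < x ∧ 0 < gStar p g x}.Subsingleton := by
      intro hs
      refine weightedTilt_not_ae_eq_zero hp hint d ?_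
      have h0 : ∀ᵐ x : ℝ, ¬ (0 < x ∧ 0 < gStar p g x) := by
        have := hs.measure_zero volume
        rw [ae_iff]
        simpa only [not_not] using this
      filter_upwards [ae_restrict_mem measurableSet_Ioi, ae_restrict_of_ae h0] with x hx hx'
      have : gStar p g x = 0 := le_antisymm (not_lt.1 fun h => hx' ⟨hx, h⟩) (gStar_nonneg hg hx)
      simp [weightedTilt, weighted, this]
    obtain ⟨x, hx, y, hy, hxy⟩ := Set.not_subsingleton_iff.1 hns
    rcases lt_or_gt_of_ne hxy with h | h
    · exact ⟨x, y, hx.1, h, hy.2⟩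
    · exact ⟨y, x, hy.1, h, hx.2⟩
  obtain ⟨M, hM, hle⟩ := hq.bounded_near_zero h₀ h01 hq₁
  have hC : 0 ≤ M * Real.exp (x₀ / 2) := by positivity
  -- Split at `x₀`. Below it `M/√x` is dominated by a kernel with `a = 1`, the factor `exp(x₀/2)`
  -- compensating its decay; above it `exp(1/x₀)` compensates `exp(-1/x)`.
  have hbound : expMix (weightedTilt p g d) 0 ≤ expMix (expKernel (M * Real.exp (x₀ / 2)) 1)
      (0 ^ 2 / 2) + ENNReal.ofReal (Real.exp (1 / x₀)) * expMix (weighted p g) 1 := by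
    rw [expMix, expMix, expMix, ← lintegral_const_mul' _ _ ENNReal.ofReal_ne_top,
      ← lintegral_add_left]
    · refine setLIntegral_mono' measurableSet_Ioi fun x hx => ?_
      have hx0 : (0 : ℝ) < x := hx
      have hw := weightedTilt_le (p := p) hg d x hx
      simp only [zero_div, neg_zero, Real.exp_zero, one_mul, ne_eq, OfNat.ofNat_ne_zero,
        not_false_eq_true, zero_pow]
      rcases lt_or_ge x x₀ with h | h
      · refine le_trans (ENNReal.ofReal_le_ofReal ?_) le_self_add
        refine hw.trans ?_
        have hs : 0 ≤ (Real.sqrt x)⁻¹ := by positivity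
        have h1 : 1 ≤ Real.exp (x₀ / 2) * Real.exp (-(1 ^ 2 * x / 2)) := by
          rw [← Real.exp_add]
          exact Real.one_le_exp (by linarith)
        calc weighted p g x ≤ (Real.sqrt x)⁻¹ * M := mul_le_mul_of_nonneg_left (hle x hx0 h) hs
          _ ≤ (Real.sqrt x)⁻¹ * M * (Real.exp (x₀ / 2) * Real.exp (-(1 ^ 2 * x / 2))) :=
            le_mul_of_one_le_right (by positivity) h1
          _ = _ := by
            rw [expKernel]
            ring
      · refine le_trans ?_ le_add_self
        rw [← ENNReal.ofReal_mul (by positivity)]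
        refine ENNReal.ofReal_le_ofReal (hw.trans ?_)
        rw [← mul_assoc, ← Real.exp_add]
        refine le_mul_of_one_le_left (weighted_nonneg hg x hx) (Real.one_le_exp ?_)
        have : 1 / x ≤ 1 / x₀ := one_div_le_one_div_of_le h₀ h
        linarith
    · have := measurable_expKernel (M * Real.exp (x₀ / 2)) 1
      fun_prop
  refine ne_top_of_le_ne_top (ENNReal.add_ne_top.2 ⟨?_, ?_⟩) hbound
  · exact expMix_expKernel_ne_top hC one_pos le_rfl
  · exact ENNReal.mul_ne_top ENNReal.ofReal_ne_top (expMix_weighted_ne_top hp hg hint one_pos)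

/-! ### Modes, log-concavity and log-convexity of the density -/

theorem normalization_pos {p : ℕ} {A : Matrix (Fin p) (Fin p) ℝ} (hA : IsUnit A.det) :
    0 < (2 * Real.pi) ^ (-(p : ℝ) / 2) * |A.det|⁻¹ := by
  have := abs_pos.2 hA.ne_zero
  positivity

theorem isLocalMax_mixtureDensity_iff {p : ℕ} {μ β : EuclideanSpace ℝ (Fin p)}
    {A : Matrix (Fin p) (Fin p) ℝ} (hA : IsUnit A.det) {g : ℝ → ℝ}
    (hg_meas : AEMeasurable g (volume.restrict (Ioi (0 : ℝ))))
    (y : EuclideanSpace ℝ (Fin p)) :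
    IsLocalMax (mixtureDensity μ β A g) y ↔
      IsLocalMax (tiltedRadial (weightedTilt p g ‖Matrix.toEuclideanLin A⁻¹ β‖)
        (Matrix.toEuclideanLin A⁻¹ β)) (Matrix.toEuclideanLin A⁻¹ (y - μ)) := by
  have hcont : ∀ B : Matrix (Fin p) (Fin p) ℝ, Continuous (Matrix.toEuclideanLin B) := fun B =>
    LinearMap.continuous_of_finiteDimensional _
  have hcomp : ∀ y z, mixtureDensity μ β A g y ≤ mixtureDensity μ β A g z ↔
      tiltedRadial (weightedTilt p g ‖Matrix.toEuclideanLin A⁻¹ β‖)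
        (Matrix.toEuclideanLin A⁻¹ β) (Matrix.toEuclideanLin A⁻¹ (y - μ)) ≤
      tiltedRadial (weightedTilt p g ‖Matrix.toEuclideanLin A⁻¹ β‖)
        (Matrix.toEuclideanLin A⁻¹ β) (Matrix.toEuclideanLin A⁻¹ (z - μ)) := by
    intro y z
    rw [mixtureDensity_eq μ β A hg_meas, mixtureDensity_eq μ β A hg_meas]
    exact ENNReal.mul_le_mul_iff_right (by simpa using normalization_pos hA)
      ENNReal.ofReal_ne_top
  constructor
  · intro h
    have ht : Filter.Tendsto (fun w => μ + Matrix.toEuclideanLin A w)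
        (nhds (Matrix.toEuclideanLin A⁻¹ (y - μ))) (nhds y) := by
      have h1 : Continuous fun w => μ + Matrix.toEuclideanLin A w :=
        continuous_const.add (hcont A)
      have h2 := h1.tendsto (Matrix.toEuclideanLin A⁻¹ (y - μ))
      rwa [toEuclideanLin_apply_inv hA, add_sub_cancel] at h2
    filter_upwards [ht.eventually h] with w hw
    rw [hcomp, add_sub_cancel_left, toEuclideanLin_inv_apply hA] at hw
    exact hw
  · intro h
    have h1 : Continuous fun y => Matrix.toEuclideanLin A⁻¹ (y - μ) :=
      (hcont A⁻¹).comp (continuous_id.sub continuous_const)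
    filter_upwards [(h1.tendsto y).eventually h] with z hz
    exact (hcomp z y).2 hz

theorem toEuclideanLin_inv_sub_eq_iff {p : ℕ} {A : Matrix (Fin p) (Fin p) ℝ} (hA : IsUnit A.det)
    (μ v y : EuclideanSpace ℝ (Fin p)) (t : ℝ) :
    Matrix.toEuclideanLin A⁻¹ (y - μ) = t • Matrix.toEuclideanLin A⁻¹ v ↔ y = μ + t • v := by
  rw [← map_smul]
  constructor
  · intro h
    have := congrArg (Matrix.toEuclideanLin A) h
    rw [toEuclideanLin_apply_inv hA, toEuclideanLin_apply_inv hA] at this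
    rw [← this, add_sub_cancel]
  · rintro rfl
    rw [add_sub_cancel_left]

theorem toEuclideanLin_inv_ne_zero {p : ℕ} {A : Matrix (Fin p) (Fin p) ℝ} (hA : IsUnit A.det)
    {v : EuclideanSpace ℝ (Fin p)} (hv : v ≠ 0) : Matrix.toEuclideanLin A⁻¹ v ≠ 0 := by
  intro h
  refine hv ?_
  rw [← toEuclideanLin_apply_inv hA v, h, map_zero]

section

variable {p : ℕ} (hp : 1 ≤ p) (μ : EuclideanSpace ℝ (Fin p)) {β : EuclideanSpace ℝ (Fin p)}
  {A : Matrix (Fin p) (Fin p) ℝ} (hA : IsUnit A.det) {g : ℝ → ℝ}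
  (hg_meas : AEMeasurable g (volume.restrict (Ioi (0 : ℝ))))
  (hg : ∀ x ∈ Ioi (0 : ℝ), 0 ≤ g x)
  (hint : ∫⁻ x in Ioi (0 : ℝ), ENNReal.ofReal (g x) = 1)

include hp hg_meas hg hint

theorem mixtureDensity_ne_top_of_logConcaveOn (hq : LogConcaveOn (Ioi 0) (gStar p g))
    (y : EuclideanSpace ℝ (Fin p)) : mixtureDensity μ β A g y ≠ ∞ := by
  rw [mixtureDensity_eq μ β A hg_meas, tiltedRadial]
  refine ENNReal.mul_ne_top ENNReal.ofReal_ne_top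
    (ENNReal.mul_ne_top ENNReal.ofReal_ne_top ?_)
  exact ne_top_of_le_ne_top (expMix_weightedTilt_zero_ne_top hp hg hint hq _)
    (expMix_anti (weightedTilt_nonneg hg _) (by positivity))

include hA

theorem isLocalMax_mixtureDensity_zero_iff (y : EuclideanSpace ℝ (Fin p)) :
    IsLocalMax (mixtureDensity μ 0 A g) y ↔ y = μ := by
  rw [isLocalMax_mixtureDensity_iff hA hg_meas, map_zero,
    isLocalMax_tiltedRadial_zero_iff (aemeasurable_weightedTilt hg_meas _)
      (weightedTilt_nonneg hg _) (weightedTilt_not_ae_eq_zero hp hint _)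
      (fun s hs => expMix_weightedTilt_ne_top hp hg hint _ hs)]
  have := toEuclideanLin_inv_sub_eq_iff hA μ 0 y 1
  simpa using this

theorem isLocalMax_mixtureDensity_iff_of_radial (hβ : β ≠ 0) {r₀ : ℝ} (hr₀ : 0 ≤ r₀)
    (h : ∀ r, 0 ≤ r → (IsLocalMaxOn (tilted (weightedTilt p g ‖Matrix.toEuclideanLin A⁻¹ β‖)
      ‖Matrix.toEuclideanLin A⁻¹ β‖) (Ici 0) r ↔ r = r₀)) (y : EuclideanSpace ℝ (Fin p)) :
    IsLocalMax (mixtureDensity μ β A g) y ↔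
      y = μ + (r₀ / ‖Matrix.toEuclideanLin A⁻¹ β‖) • β := by
  rw [isLocalMax_mixtureDensity_iff hA hg_meas,
    isLocalMax_tiltedRadial_iff (weightedTilt_nonneg hg _)
      (fun s => expMix_pos (aemeasurable_weightedTilt hg_meas _) (weightedTilt_nonneg hg _)
        (weightedTilt_not_ae_eq_zero hp hint _) s)
      (fun s hs => expMix_weightedTilt_ne_top hp hg hint _ hs)
      (toEuclideanLin_inv_ne_zero hA hβ) hr₀ h, toEuclideanLin_inv_sub_eq_iff hA]

theorem exists_isLocalMax_mixtureDensity_iff (hq : UnimodalOn (Ioi 0) (gStar p g)) :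
    ∃ t : ℝ, ∀ y, IsLocalMax (mixtureDensity μ β A g) y ↔ y = μ + t • β := by
  by_cases hβ : β = 0
  · subst hβ
    exact ⟨0, fun y => by
      rw [isLocalMax_mixtureDensity_zero_iff hp μ hA hg_meas hg hint, smul_zero, add_zero]⟩
  have hd : 0 < ‖Matrix.toEuclideanLin A⁻¹ β‖ :=
    norm_pos_iff.2 (toEuclideanLin_inv_ne_zero hA hβ)
  have hm := aemeasurable_weightedTilt (p := p) hg_meas ‖Matrix.toEuclideanLin A⁻¹ β‖
  have hn := weightedTilt_nonneg (p := p) hg ‖Matrix.toEuclideanLin A⁻¹ β‖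
  have hfin := fun s hs =>
    expMix_weightedTilt_ne_top hp hg hint ‖Matrix.toEuclideanLin A⁻¹ β‖ (s := s) hs
  obtain ⟨r₀, hr₀, h⟩ := existsUnique_localMax_of_quasiconcave
    (upperSemicontinuousOn_tilted hm hn hfin ‖Matrix.toEuclideanLin A⁻¹ β‖)
    (tendsto_tilted_atTop hd hm (weighted_nonneg (p := p) hg)
      (expMix_weighted_ne_top hp hg hint (by norm_num)) (fun x _ => rfl))
    (tilted_pos hm hn (weightedTilt_not_ae_eq_zero hp hint _) _ _)
    (fun r₁ r₂ r₃ h₁ h12 h23 hle => tilted_strict_quasiconcave hm hn hfin hd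
      (weightedTilt_not_ae_eq_expKernel hp hint _) (fun c _ => by
        convert hq.ordConnected c using 1
        ext x
        simp only [mem_ofPred_eq]
        refine and_congr_right fun hx => ?_
        rw [expKernel_le_weightedTilt_iff hx]
        simp) h₁ h12 h23 hle)
  exact ⟨_, isLocalMax_mixtureDensity_iff_of_radial hp μ hA hg_meas hg hint hβ hr₀ h⟩

theorem isLocalMax_mixtureDensity_iff_of_antitoneOn (hq : AntitoneOn (gStar p g) (Ioi 0))
    (y : EuclideanSpace ℝ (Fin p)) : IsLocalMax (mixtureDensity μ β A g) y ↔ y = μ := by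
  by_cases hβ : β = 0
  · subst hβ
    exact isLocalMax_mixtureDensity_zero_iff hp μ hA hg_meas hg hint y
  have hd : 0 < ‖Matrix.toEuclideanLin A⁻¹ β‖ :=
    norm_pos_iff.2 (toEuclideanLin_inv_ne_zero hA hβ)
  have hanti := tilted_strictAntiOn (aemeasurable_weightedTilt (p := p) hg_meas _)
    (weightedTilt_nonneg (p := p) hg _)
    (fun s hs => expMix_weightedTilt_ne_top hp hg hint ‖Matrix.toEuclideanLin A⁻¹ β‖ (s := s) hs)
    hd (weightedTilt_not_ae_eq_expKernel hp hint _) (fun c _ x hx y hy hyx => by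
      have hx0 := hy.trans_le hyx
      rw [expKernel_le_weightedTilt_iff hx0] at hx
      rw [expKernel_le_weightedTilt_iff hy]
      simp only [sub_self, zero_div, zero_mul, Real.exp_zero, mul_one] at hx ⊢
      exact hx.trans (hq hy hx0 hyx))
  rw [isLocalMax_mixtureDensity_iff_of_radial hp μ hA hg_meas hg hint hβ le_rfl
    (fun r hr => isLocalMaxOn_iff_of_strictAntiOn hanti hr), zero_div, zero_smul, add_zero]

/-- The tilt is log-linear in `w`. The radial factor is a decreasing log-concave function of `‖w‖`,
and the norm is convex, so the composite is log-concave. -/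
theorem mixtureDensity_logConcaveOn (hq : LogConcaveOn (Ioi 0) (gStar p g)) :
    LogConcaveOn univ (fun y => (mixtureDensity μ β A g y).toReal) := by
  refine ⟨convex_univ, fun _ _ => ENNReal.toReal_nonneg, fun y _ z _ t ht => ?_⟩
  set γ := Matrix.toEuclideanLin A⁻¹ β with hγ
  set G := weightedTilt p g ‖γ‖ with hG
  set C := (2 * Real.pi) ^ (-(p : ℝ) / 2) * |A.det|⁻¹
  have hC : 0 < C := normalization_pos hA
  have hfin : ∀ s, 0 ≤ s → expMix G s ≠ ∞ := fun s hs =>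
    ne_top_of_le_ne_top (expMix_weightedTilt_zero_ne_top hp hg hint hq _)
      (expMix_anti (weightedTilt_nonneg hg _) hs)
  have hval : ∀ y, (mixtureDensity μ β A g y).toReal =
      C * (Real.exp (inner ℝ (Matrix.toEuclideanLin A⁻¹ (y - μ)) γ) *
        (expMix G (‖Matrix.toEuclideanLin A⁻¹ (y - μ)‖ ^ 2 / 2)).toReal) := by
    intro y
    rw [mixtureDensity_eq μ β A hg_meas, tiltedRadial, ENNReal.toReal_mul, ENNReal.toReal_mul,
      ENNReal.toReal_ofReal hC.le, ENNReal.toReal_ofReal (Real.exp_pos _).le]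
  have hconv : Matrix.toEuclideanLin A⁻¹ (t • y + (1 - t) • z - μ) =
      t • Matrix.toEuclideanLin A⁻¹ (y - μ) + (1 - t) • Matrix.toEuclideanLin A⁻¹ (z - μ) := by
    rw [← map_smul, ← map_smul, ← map_add]
    congr 1
    module
  simp only [hval, hconv]
  set w := Matrix.toEuclideanLin A⁻¹ (y - μ)
  set v := Matrix.toEuclideanLin A⁻¹ (z - μ)
  have ht1 : 0 < 1 - t := sub_pos.2 ht.2
  have h1 := expMix_logConcave (aemeasurable_weightedTilt hg_meas _) (weightedTilt_nonneg hg _)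
    (weightedTilt_not_ae_eq_zero hp hint ‖γ‖) hfin (fun c a hc => by
      convert hq.ordConnected hc ((‖γ‖ ^ 2 - a ^ 2) / 2) using 1
      ext x
      exact and_congr_right fun hx => expKernel_le_weightedTilt_iff hx)
    (norm_nonneg w) (norm_nonneg v) ht
  have hnorm : ‖t • w + (1 - t) • v‖ ≤ t * ‖w‖ + (1 - t) * ‖v‖ := by
    refine (norm_add_le _ _).trans_eq ?_
    rw [norm_smul, norm_smul, Real.norm_of_nonneg ht.1.le, Real.norm_of_nonneg ht1.le]
  have h2 : (expMix G ((t * ‖w‖ + (1 - t) * ‖v‖) ^ 2 / 2)).toReal ≤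
      (expMix G (‖t • w + (1 - t) • v‖ ^ 2 / 2)).toReal :=
    ENNReal.toReal_mono (hfin _ (by positivity))
      (expMix_anti (weightedTilt_nonneg hg _) (by gcongr))
  have h12 := h1.trans h2
  rw [Real.mul_rpow hC.le (by positivity), Real.mul_rpow hC.le (by positivity),
    Real.mul_rpow (Real.exp_pos _).le ENNReal.toReal_nonneg,
    Real.mul_rpow (Real.exp_pos _).le ENNReal.toReal_nonneg, ← Real.exp_mul, ← Real.exp_mul]
  have hCC : C ^ t * C ^ (1 - t) = C := by
    rw [← Real.rpow_add hC, add_sub_cancel, Real.rpow_one]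
  have hexp : Real.exp (inner ℝ w γ * t) * Real.exp (inner ℝ v γ * (1 - t)) =
      Real.exp (inner ℝ (t • w + (1 - t) • v) γ) := by
    rw [← Real.exp_add, inner_add_left, real_inner_smul_left, real_inner_smul_left]
    congr 1
    ring
  rw [← hexp]
  nth_rewrite 3 [← hCC]
  rw [mul_mul_mul_comm, mul_mul_mul_comm (Real.exp (inner ℝ w γ * t))]
  gcongr

theorem mixtureDensity_ray_ne_top {b : EuclideanSpace ℝ (Fin p)} (hb : b ≠ 0) {t : ℝ}
    (ht : 0 < t) : mixtureDensity μ β A g (μ + t • b) ≠ ∞ := by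
  rw [mixtureDensity_eq μ β A hg_meas, tiltedRadial, add_sub_cancel_left, map_smul]
  refine ENNReal.mul_ne_top ENNReal.ofReal_ne_top
    (ENNReal.mul_ne_top ENNReal.ofReal_ne_top ?_)
  refine expMix_weightedTilt_ne_top hp hg hint _ ?_
  have := norm_pos_iff.2 (smul_ne_zero ht.ne' (toEuclideanLin_inv_ne_zero hA hb))
  positivity

/-- Along a ray from `μ` both `‖w‖` and `⟨w, γ⟩` are linear in `t`, so log-convexity of the
transform in `r` passes directly to the density. -/
theorem mixtureDensity_ray_logConvexOn (hq : LogConvexOn (Ioi 0) (gStar p g))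
    {b : EuclideanSpace ℝ (Fin p)} (hb : b ≠ 0) :
    LogConvexOn (Ioi 0) (fun t => (mixtureDensity μ β A g (μ + t • b)).toReal) := by
  set γ := Matrix.toEuclideanLin A⁻¹ β with hγ
  set w := Matrix.toEuclideanLin A⁻¹ b with hw
  set G := weightedTilt p g ‖γ‖ with hG
  set C := (2 * Real.pi) ^ (-(p : ℝ) / 2) * |A.det|⁻¹
  have hC : 0 < C := normalization_pos hA
  have hw0 : 0 < ‖w‖ := norm_pos_iff.2 (toEuclideanLin_inv_ne_zero hA hb)
  have hm : AEMeasurable G (volume.restrict (Ioi (0 : ℝ))) := aemeasurable_weightedTilt hg_meas _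
  have hn : ∀ x ∈ Ioi (0 : ℝ), 0 ≤ G x := weightedTilt_nonneg hg _
  have hne := weightedTilt_not_ae_eq_zero hp hint ‖γ‖
  have hfin : ∀ s, 0 < s → expMix G s ≠ ∞ := fun s hs =>
    expMix_weightedTilt_ne_top hp hg hint _ hs
  have hpos : ∀ r, 0 < r → 0 < (expMix G (r ^ 2 / 2)).toReal := fun r hr =>
    ENNReal.toReal_pos (expMix_pos hm hn hne _).ne' (hfin _ (by positivity))
  have hval : ∀ t ∈ Ioi (0 : ℝ), (mixtureDensity μ β A g (μ + t • b)).toReal =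
      C * (Real.exp (t * inner ℝ w γ) * (expMix G ((‖w‖ * t) ^ 2 / 2)).toReal) := by
    intro t ht
    have ht0 : (0 : ℝ) < t := ht
    rw [mixtureDensity_eq μ β A hg_meas, tiltedRadial, ENNReal.toReal_mul, ENNReal.toReal_mul,
      ENNReal.toReal_ofReal hC.le, ENNReal.toReal_ofReal (Real.exp_pos _).le, add_sub_cancel_left,
      map_smul, real_inner_smul_left, norm_smul, Real.norm_of_nonneg ht0.le, mul_comm t ‖w‖]
  have hconv := expMix_logConvex hm hn hne hfin (fun c a hc => by
      convert hq.ordConnected hc ((‖γ‖ ^ 2 - a ^ 2) / 2) using 1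
      ext x
      exact and_congr_right fun hx => weightedTilt_le_expKernel_iff hx)
  refine ⟨fun t ht => ?_, convex_Ioi 0, fun t ht u hu a b' ha hb' hab => ?_⟩
  · have ht0 : (0 : ℝ) < t := ht
    dsimp only
    rw [hval t ht]
    have := hpos (‖w‖ * t) (by positivity)
    positivity
  · have hlog : ∀ t ∈ Ioi (0 : ℝ), Real.log (mixtureDensity μ β A g (μ + t • b)).toReal =
        Real.log C + t * inner ℝ w γ + Real.log (expMix G ((‖w‖ * t) ^ 2 / 2)).toReal := by
      intro t ht
      have ht0 : (0 : ℝ) < t := ht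
      have := hpos (‖w‖ * t) (by positivity)
      rw [hval t ht, Real.log_mul hC.ne' (by positivity), Real.log_mul (Real.exp_pos _).ne' this.ne',
        Real.log_exp, add_assoc]
    have hmem := convex_Ioi (0 : ℝ) ht hu ha hb' hab
    have h1 := hconv.2 (mem_Ioi.2 (mul_pos hw0 ht)) (mem_Ioi.2 (mul_pos hw0 hu)) ha hb' hab
    dsimp only
    rw [hlog t ht, hlog u hu, hlog _ hmem]
    simp only [smul_eq_mul] at h1 ⊢
    rw [show a * (‖w‖ * t) + b' * (‖w‖ * u) = ‖w‖ * (a * t + b' * u) by ring] at h1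
    linear_combination h1 - Real.log C * hab

end

end NormalMixture

theorem theorem2
    (p : ℕ) (hp : 1 ≤ p)
    (μ β : EuclideanSpace ℝ (Fin p)) (A : Matrix (Fin p) (Fin p) ℝ) (hA : A.rank = p)
    -- the mixing density
    (g : ℝ → ℝ) (hg_meas : AEMeasurable g (volume.restrict (Ioi (0 : ℝ))))
    (hg_nonneg : ∀ x ∈ Ioi (0 : ℝ), 0 ≤ g x)
    -- `X` has density `g` on `(0, ∞)`, `Z` is standard normal, and they are independent
    {Ω : Type*} [MeasurableSpace Ω] (P : Measure Ω) [IsProbabilityMeasure P]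
    (X : Ω → ℝ) (Z : Ω → EuclideanSpace ℝ (Fin p))
    (hX : HasLaw X ((volume.restrict (Ioi (0 : ℝ))).withDensity
      (fun x => ENNReal.ofReal (g x))) P)
    (hZ : HasLaw Z (stdGaussian (EuclideanSpace ℝ (Fin p))) P)
    (hXZ : IndepFun X Z P)
    (Y : Ω → EuclideanSpace ℝ (Fin p))
    (hY : ∀ ω, Y ω = μ + X ω • β + Real.sqrt (X ω) • Matrix.toEuclideanLin A (Z ω))
    (f : EuclideanSpace ℝ (Fin p) → ℝ≥0∞)
    (hf : f = NormalMixture.mixtureDensity μ β A g) :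
    -- `f` is a density of `Y`
    HasLaw Y ((volume : Measure (EuclideanSpace ℝ (Fin p))).withDensity f) P ∧
    -- (i)
    (NormalMixture.UnimodalOn (Ioi 0) (NormalMixture.gStar p g) →
      ∃ t : ℝ, ∀ y, IsLocalMax f y ↔ y = μ + t • β) ∧
    -- (ii)
    (AntitoneOn (NormalMixture.gStar p g) (Ioi 0) ∨ β = 0 →
      ∀ y, IsLocalMax f y ↔ y = μ) ∧
    -- (iii)
    (NormalMixture.LogConcaveOn (Ioi 0) (NormalMixture.gStar p g) →
      (∀ y, f y ≠ ∞) ∧ NormalMixture.LogConcaveOn univ (fun y => (f y).toReal)) ∧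
    -- (iv)
    (NormalMixture.LogConvexOn (Ioi 0) (NormalMixture.gStar p g) →
      ∀ b : EuclideanSpace ℝ (Fin p), b ≠ 0 →
        (∀ t ∈ Ioi (0 : ℝ), f (μ + t • b) ≠ ∞) ∧
        NormalMixture.LogConvexOn (Ioi 0) (fun t => (f (μ + t • b)).toReal)) := by
  subst hf
  have hdet := NormalMixture.isUnit_det_of_rank_eq hA
  -- That `g` has total mass one is read off from its being the density of the random variable `X`.
  have hint : ∫⁻ x in Ioi (0 : ℝ), ENNReal.ofReal (g x) = 1 := by
    have h1 : P.map X univ = 1 := by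
      rw [Measure.map_apply_of_aemeasurable hX.aemeasurable MeasurableSet.univ, preimage_univ,
        measure_univ]
    rwa [hX.map_eq, withDensity_apply _ MeasurableSet.univ, Measure.restrict_univ] at h1
  refine ⟨?_, fun hq => ?_, fun hq y => ?_, fun hq => ⟨?_, ?_⟩, fun hq b hb => ⟨?_, ?_⟩⟩
  · rw [show Y = _ from funext hY]
    exact NormalMixture.hasLaw_mixture μ β hdet hg_meas hX hZ hXZ
  · exact NormalMixture.exists_isLocalMax_mixtureDensity_iff hp μ hdet hg_meas hg_nonneg hint hq
  · rcases hq with hq | rfl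
    · exact NormalMixture.isLocalMax_mixtureDensity_iff_of_antitoneOn hp μ hdet hg_meas hg_nonneg
        hint hq y
    · exact NormalMixture.isLocalMax_mixtureDensity_zero_iff hp μ hdet hg_meas hg_nonneg hint y
  · exact NormalMixture.mixtureDensity_ne_top_of_logConcaveOn hp μ hg_meas hg_nonneg hint hq
  · exact NormalMixture.mixtureDensity_logConcaveOn hp μ hdet hg_meas hg_nonneg hint hq
  · exact fun t ht =>
      NormalMixture.mixtureDensity_ray_ne_top hp μ hdet hg_meas hg_nonneg hint hb ht
  · exact NormalMixture.mixtureDensity_ray_logConvexOn hp μ hdet hg_meas hg_nonneg hint hq hb
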